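/- **Lemma 2.7.** Let $q$ be a prime, $k$ a natural number, $\eta,b\in\mathbb R$ (with the conventions $0^0=1$ and $0^b=0$ for $b<0$, relevant only if $b\le 0$), and let $M\in\mathbb F_q^{k\times k}$ be a *mixing* matrix, i.e. $M$ is invertible and no permutation of its rows makes it upper triangular. For a pair $(U,A)$ of discrete random variables with $U\in\mathbb F_q$ let $\overline H(U\mid A)=H(U\mid A)/\log q\in[0,1]$ be the normalized conditional entropy. Suppose that $M$ satisfies *$(\eta,b)$-exponential polarization*: there is $\tau>0$ such that for every $\delta<\tau$, every alphabet $\Sigma$ and all i.i.d. discrete pairs $(U_1,A_1),\dots,(U_k,A_k)\in\mathbb F_q\times\Sigma$ with $\overline H(U_i\mid A_i)\le\delta$, writing $U=(U_1,\dots,U_k)$ (a row vector) and $A=(A_1,\dots,A_k)$, one has $\overline H\big((UM)_j\mid (UM)_{<j},A\big)\le\delta^b$ for at least $\eta k$ of the indices $j\in[k]$. Let $C$ be any channel from $\mathbb F_q$ to a discrete alphabet $\mathcal Y$ (for every $x\in\mathbb F_q$ a discrete probability distribution $C_{Y\mid Z=x}$ on $\mathcal Y$). Define distributions $D_t$ on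 $\mathbb F_q^{[k]^t}\times\mathcal Y^{[k]^t}$, $t\ge 0$, as follows. A sample $(A,B)\sim D_0$ consists of a uniform $A\in\mathbb F_q$ and $B\sim C_{Y\mid Z=A}$. For $t\ge1$, a sample $(A',B')\sim D_t$ is obtained from $k$ independent samples $(A^{(1)},B^{(1)}),\dots,(A^{(k)},B^{(k)})\sim D_{t-1}$ by $(A'_{[i,1]},\dots,A'_{[i,k]})=(A^{(1)}_i,\dots,A^{(k)}_i)\cdot M$ for all $i\in[k]^{t-1}$ and $B'=(B^{(1)},\dots,B^{(k)})$. Let $i_1,i_2,\dots$ be i.i.d. uniform in $[k]$ and let the *Arıkan martingale* associated with $M$ and $C$ be $$X_t:=\overline H\big(A_{\mathbf j}\mid A_{\prec\mathbf j},B\big),\qquad \mathbf j=(i_1,\dots,i_t),\quad (A,B)\sim D_t,$$ where $\prec$ is the lexicographic order on $[k]^t$; the only randomness in $X_t$ is that of $\mathbf j$. Then $(X_t)_{t\ge0}$ is *$(\eta,b)$-exponentially locally polarizing*, that is, it is a $[0,1]$-valued martingale (with respect to its own history) and, almost surely, 1. (variance in the middle) for every $\tau>0$ there is $\theta>0$ such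 that for all $j$: if $X_j\in(\tau,1-\tau)$ then $\mathbb E[(X_{j+1}-X_j)^2\mid X_j]\ge\theta$; 2. (suction at the ends) there is $\alpha>0$ such that for every $0<c<\infty$ there is $\tau>0$ such that for all $j$: if $X_j\le\tau$ then $\Pr[X_{j+1}\le X_j/c\mid X_j]\ge\alpha$, and if $1-X_j\le\tau$ then $\Pr[1-X_{j+1}\le(1-X_j)/c\mid X_j]\ge\alpha$; 3. (strong suction at the low end) there is $\tau>0$ such that for all $j$: if $X_j\le\tau$ then $\Pr[X_{j+1}\le X_j^{\,b}\mid X_j]\ge\eta$. -/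

import Mathlib

open MeasureTheory ProbabilityTheory
open scoped ENNReal

universe u v

noncomputable section

/-! ### Entropy and product laws of discrete random variables -/

/-- The normalized conditional entropy `H(U | A) / log q` of a pair `(U, A)` of discrete random
variables with joint law `p`, where `U` takes values in a set of size `q`:
`(1 / log q) * ∑ a, P(A = a) * H(U | A = a)`. -/
def condEntropy {q : ℕ} [NeZero q] {S : Type u} (p : PMF (ZMod q × S)) : ℝ :=
  (∑' a : S, ((p.map Prod.snd) a).toReal *
      ∑ x : ZMod q, Real.negMulLog ((p (x, a)).toReal / ((p.map Prod.snd) a).toReal)) /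
    Real.log q

/-- The joint law of `n` independent samples from `p`. -/
def iidLaw {α : Type u} (p : PMF α) : (n : ℕ) → PMF (Fin n → α)
  | 0 => PMF.pure Fin.elim0
  | n + 1 => p.bind fun a => (iidLaw p n).map fun g => (Fin.cons a g : Fin (n + 1) → α)

/-- The probability mass of a tuple under `iidLaw` is the product of the masses of its entries. -/
theorem iidLaw_apply {α : Type u} (p : PMF α) (n : ℕ) (f : Fin n → α) :
    iidLaw p n f = ∏ i, p (f i) := by
  classical
  induction n with
  | zero =>
    have : f = Fin.elim0 := Subsingleton.elim _ _
    simp [iidLaw, this]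
  | succ n ih =>
    have key : ∀ a : α, ((iidLaw p n).map fun g => (Fin.cons a g : Fin (n + 1) → α)) f
        = if a = f 0 then iidLaw p n (Fin.tail f) else 0 := by
      intro a
      rw [PMF.map_apply]
      split_ifs with h
      · rw [tsum_eq_single (Fin.tail f)]
        · simp [h]
        · intro g hg
          rw [if_neg]
          rintro rfl
          exact hg (by simp)
      · refine ENNReal.tsum_eq_zero.2 fun g => if_neg ?_
        rintro rfl
        exact h (by simp)
    simp only [iidLaw, PMF.bind_apply, key]
    rw [tsum_eq_single (f 0)]
    · rw [if_pos rfl, ih, Fin.prod_univ_succ]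
      rfl
    · intro a ha
      simp [ha]

/-! ### Matrices -/

/-- A square matrix is mixing if it is invertible and no permutation of its rows makes it upper
triangular. -/
def IsMixing {q k : ℕ} (M : Matrix (Fin k) (Fin k) (ZMod q)) : Prop :=
  IsUnit M ∧ ∀ σ : Equiv.Perm (Fin k), ¬ (M.submatrix σ id).IsUpperTriangular

/-- For `(U, A) = ((U₁, A₁), …, (Uₖ, Aₖ))`, the pair consisting of `(U M)_j` and of
`((U M)_{<j}, A)`. -/
def matrixStep {q k : ℕ} {S : Type u} (M : Matrix (Fin k) (Fin k) (ZMod q)) (j : Fin k)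
    (z : Fin k → ZMod q × S) : ZMod q × (({i : Fin k // i < j} → ZMod q) × (Fin k → S)) :=
  let V : Fin k → ZMod q := Matrix.vecMul (fun i => (z i).1) M
  (V j, (fun i => V i, fun i => (z i).2))

/-- `(η, b)`-exponential polarization of a matrix `M`: there is `τ > 0` such that whenever
`(U₁, A₁), …, (Uₖ, Aₖ)` are i.i.d. with `H(Uᵢ | Aᵢ) ≤ δ < τ`, one has
`H((U M)_j | (U M)_{<j}, A) ≤ δ ^ b` for at least an `η` fraction of the indices `j`.
The alphabet `S` of the `Aᵢ` and their common joint law `p` with `Uᵢ` are arbitrary. -/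
def ExpPolarizingMatrix {q k : ℕ} [NeZero q] (M : Matrix (Fin k) (Fin k) (ZMod q))
    (η b : ℝ) : Prop :=
  ∃ τ : ℝ, 0 < τ ∧ ∀ δ : ℝ, δ < τ → ∀ (S : Type u) (p : PMF (ZMod q × S)), condEntropy p ≤ δ →
    η * k ≤ ({j : Fin k | condEntropy ((iidLaw p k).map (matrixStep M j)) ≤ δ ^ b}.ncard : ℝ)

/-! ### Local polarization of martingales -/

section Martingales

variable {Ω : Type u} [MeasurableSpace Ω]

/-- A `[0,1]`-bounded martingale (with respect to its own history). -/
structure IsUnitMartingale (X : ℕ → Ω → ℝ) (P : Measure Ω) : Prop where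
  mem_Icc : ∀ t ω, X t ω ∈ Set.Icc (0 : ℝ) 1
  martingale : ∃ hX : ∀ t, StronglyMeasurable (X t), Martingale X (Filtration.natural X hX) P

/-- The conditional expectation `E[f | Y]` given a real random variable `Y`. -/
def expGiven (P : Measure Ω) (f Y : Ω → ℝ) : Ω → ℝ :=
  P[f | MeasurableSpace.comap Y inferInstance]

/-- The conditional probability `P[E | Y]` of an event given a real random variable `Y`. -/
def probGiven (P : Measure Ω) (E : Set Ω) (Y : Ω → ℝ) : Ω → ℝ :=
  expGiven P (E.indicator fun _ => 1) Y

/-- Local polarization of a `[0,1]`-bounded martingale. -/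
structure LocallyPolarizing (X : ℕ → Ω → ℝ) (P : Measure Ω) : Prop
    extends IsUnitMartingale X P where
  variance_in_the_middle : ∀ τ : ℝ, 0 < τ → ∃ θ : ℝ, 0 < θ ∧ ∀ j : ℕ, ∀ᵐ ω ∂P,
    X j ω ∈ Set.Ioo τ (1 - τ) → θ ≤ expGiven P (fun ω' => (X (j + 1) ω' - X j ω') ^ 2) (X j) ω
  suction_at_the_ends : ∃ α : ℝ, 0 < α ∧ ∀ c : ℝ, 0 < c → ∃ τ : ℝ, 0 < τ ∧ ∀ j : ℕ, ∀ᵐ ω ∂P,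
    (X j ω ≤ τ → α ≤ probGiven P {ω' | X (j + 1) ω' ≤ X j ω' / c} (X j) ω) ∧
    (1 - X j ω ≤ τ → α ≤ probGiven P {ω' | 1 - X (j + 1) ω' ≤ (1 - X j ω') / c} (X j) ω)

/-- `(η, b)`-exponential local polarization of a `[0,1]`-bounded martingale. -/
structure ExpLocallyPolarizing (X : ℕ → Ω → ℝ) (P : Measure Ω) (η b : ℝ) : Prop
    extends LocallyPolarizing X P where
  strong_suction_at_the_low_end : ∃ τ : ℝ, 0 < τ ∧ ∀ j : ℕ, ∀ᵐ ω ∂P,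
    X j ω ≤ τ → η ≤ probGiven P {ω' | X (j + 1) ω' ≤ X j ω' ^ b} (X j) ω

end Martingales

/-! ### The Arıkan martingale -/

section Arikan

variable {q k : ℕ} {Y : Type u}

/-- The pair `(A', B')` built from `k` samples `(A⁽ˢ⁾, B⁽ˢ⁾)`: `A'_{[i, ·]}` is the row vector
`(A⁽¹⁾_i, …, A⁽ᵏ⁾_i)` times `M`, and `B'` is the concatenation of `B⁽¹⁾, …, B⁽ᵏ⁾`. Vectors of
length `k ^ t` are indexed by `t`-tuples of elements of `Fin k`. -/
def arikanCombine (M : Matrix (Fin k) (Fin k) (ZMod q)) (t : ℕ)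
    (z : Fin k → ((Fin t → Fin k) → ZMod q) × ((Fin t → Fin k) → Y)) :
    ((Fin (t + 1) → Fin k) → ZMod q) × ((Fin (t + 1) → Fin k) → Y) :=
  (fun j => Matrix.vecMul (fun s => (z s).1 (Fin.init j)) M (j (Fin.last t)),
   fun j => (z (j 0)).2 (Fin.tail j))

/-- The law `D_t` of the pair `(A, B)` in `𝔽_q ^ (k ^ t) × Y ^ (k ^ t)`; `C x` is the law of the
output of the channel on input `x`. -/
def arikanLaw [NeZero q] (M : Matrix (Fin k) (Fin k) (ZMod q)) (C : ZMod q → PMF Y) :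
    (t : ℕ) → PMF (((Fin t → Fin k) → ZMod q) × ((Fin t → Fin k) → Y))
  | 0 => (PMF.uniformOfFintype (ZMod q)).bind fun x => (C x).map fun y => (fun _ => x, fun _ => y)
  | t + 1 => (iidLaw (arikanLaw M C t) k).map (arikanCombine M t)

/-- For a pair `(A, B)` and an index `j`, the pair consisting of `A_j` and of `(A_{≺ j}, B)`, where
`≺` is the lexicographic order on tuples. -/
def splitAt {t : ℕ} (j : Fin t → Fin k)
    (z : ((Fin t → Fin k) → ZMod q) × ((Fin t → Fin k) → Y)) :
    ZMod q × (({i : Fin t → Fin k // toLex i < toLex j} → ZMod q) × ((Fin t → Fin k) → Y)) :=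
  (z.1 j, (fun i => z.1 i, z.2))

/-- The entropy `H(A_j | A_{≺ j}, B)` for `(A, B)` distributed as `D_t`. -/
def arikanEntropy [NeZero q] (M : Matrix (Fin k) (Fin k) (ZMod q)) (C : ZMod q → PMF Y) {t : ℕ}
    (j : Fin t → Fin k) : ℝ :=
  condEntropy ((arikanLaw M C t).map (splitAt j))

/-- The Arıkan martingale `X_t = H(A_j | A_{≺ j}, B)` with `(A, B) ∼ D_t` and random index
`j = (i_1, …, i_t)`; the indices are numbered from `0`, so that
`i s` is the coordinate number `s + 1` of `j`. -/
def arikanMartingale [NeZero q] {Ω : Type v} (M : Matrix (Fin k) (Fin k) (ZMod q))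
    (C : ZMod q → PMF Y) (i : ℕ → Ω → Fin k) (t : ℕ) (ω : Ω) : ℝ :=
  arikanEntropy M C fun s : Fin t => i s ω

end Arikan

end

/-! The martingale reads off a function on the `k`-ary tree of digit strings along a random branch,
and every local property concerns a node and its children. Because `M` is invertible, the outputs of
the earlier blocks at level `t + 1` carry the same information as the entries `A_{≺ j}` of the `k`
copies at level `t`. Hence the children of the node `j` are the entropies of the successive outputs
when `M` acts on `k` independent copies of `(A_j, (A_{≺ j}, B))` (`arikanEntropy_succ`). The next
digit is uniform and independent of the past, so it suffices that the children average to the parent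
and that, in each regime, one child moves enough; that child has probability `1 / k`
(`expLocallyPolarizing_of_tree`). The average is the chain rule, and strong suction is the
polarization hypothesis itself.

The moving child comes from mixing. Two rows of `M` share their leading column, and the output there
has entropy at least that of a sum `a U_i + b U_{i'}` of two independent terms
(`exists_le_stepEnt`). Dually, two columns of `M⁻¹` share their last nonzero row, and the output
there has entropy at most `2 H` minus that of such a sum (`exists_stepEnt_le`).

It remains to bound the entropy of the sum: it exceeds `H` by a definite amount in the middle, its
deficit is quadratic near the top, and it is almost `2 H` near the bottom. For probability vectors
these are the convolution inequalities `vecEntropy_addConv_gain`, `entropy_deficit_addConv_le` and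
`exists_vecEntropy_add_le_addConv`. Each is, or implies, a lower bound bilinear in the two
entropies, and such a bound can be averaged over independent side information without loss
(`bilinear_le_condEnt_add`). -/

/-! ### Entropy of probability vectors -/

section VecEntropy

open Real Finset

/-- The entropy, in nats, of a probability vector. -/
noncomputable def vecEntropy {F : Type*} [Fintype F] (P : F → ℝ) : ℝ := ∑ x, negMulLog (P x)

/-- Additive convolution of two vectors indexed by a finite group. -/
def addConv {G : Type*} [Fintype G] [AddCommGroup G] (P Q : G → ℝ) (x : G) : ℝ :=
  ∑ y, P (x - y) * Q y

/-- The second derivative is `1 - 1 / x`, which is nonpositive on the unit interval. This strong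
concavity produces the variance term in Jensen's inequality, the source of the quantitative entropy
gains. -/
theorem concaveOn_negMulLog_add_sq :
    ConcaveOn ℝ (Set.Icc (0 : ℝ) 1) fun x => negMulLog x + x ^ 2 / 2 := by
  refine concaveOn_of_hasDerivWithinAt2_nonpos (f' := fun x => - log x - 1 + x)
    (f'' := fun x => -x⁻¹ + 1) (convex_Icc 0 1) (by fun_prop) ?_ ?_ ?_
  · intro x hx
    rw [interior_Icc] at hx
    have h := (hasDerivAt_negMulLog hx.1.ne').add ((hasDerivAt_pow 2 x).div_const 2)
    refine (h.congr_deriv ?_).hasDerivWithinAt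
    simp
  · intro x hx
    rw [interior_Icc] at hx
    have h := (((hasDerivAt_log hx.1.ne').neg).sub_const 1).add (hasDerivAt_id x)
    exact h.hasDerivWithinAt
  · intro x hx
    rw [interior_Icc] at hx
    have : 1 ≤ x⁻¹ := (one_le_inv₀ hx.1).2 hx.2.le
    linarith

/-- Jensen's inequality for `negMulLog` with a quadratic gain. -/
theorem sum_mul_negMulLog_add_le {ι : Type*} [Fintype ι] {w x : ι → ℝ}
    (hw : w ∈ stdSimplex ℝ ι) (hx : ∀ i, x i ∈ Set.Icc (0 : ℝ) 1) :
    ∑ i, w i * negMulLog (x i) + (∑ i, w i * x i ^ 2 - (∑ i, w i * x i) ^ 2) / 2 ≤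
      negMulLog (∑ i, w i * x i) := by
  have h := concaveOn_negMulLog_add_sq.le_map_sum (t := univ) (w := w) (p := x)
    (fun i _ => hw.1 i) hw.2 (fun i _ => hx i)
  simp only [smul_eq_mul, mul_add, sum_add_distrib] at h
  have : ∑ i, w i * (x i ^ 2 / 2) = (∑ i, w i * x i ^ 2) / 2 := by
    rw [sum_div]; exact sum_congr rfl fun i _ => by ring
  linarith

theorem vecEntropy_nonneg {F : Type*} [Fintype F] {P : F → ℝ} (hP : P ∈ stdSimplex ℝ F) :
    0 ≤ vecEntropy P :=
  sum_nonneg fun x _ => negMulLog_nonneg (mem_Icc_of_mem_stdSimplex hP x).1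
    (mem_Icc_of_mem_stdSimplex hP x).2

/-- `∑ P ^ 2` exceeds its minimum `1 / |F|` by at most twice the entropy deficit over `|F|`. -/
theorem sum_sq_sub_le_entropy_deficit {F : Type*} [Fintype F] {P : F → ℝ}
    (hP : P ∈ stdSimplex ℝ F) :
    (∑ x, P x ^ 2 - (Fintype.card F : ℝ)⁻¹) / 2 ≤ log (Fintype.card F) - vecEntropy P := by
  have : Nonempty F := by
    by_contra h
    rw [not_nonempty_iff] at h
    simpa using hP.2
  set n : ℝ := (Fintype.card F : ℝ) with hn
  have hn0 : 0 < n := by rw [hn]; exact_mod_cast Fintype.card_pos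
  -- Jensen with uniform weights: the mean of `P` is `1 / n`, and `n * negMulLog (1 / n) = log n`.
  have h := sum_mul_negMulLog_add_le (w := fun _ : F => n⁻¹) (x := P)
    ⟨fun _ => by positivity, by simp [← hn, hn0.ne']⟩ (mem_Icc_of_mem_stdSimplex hP)
  simp only [← mul_sum, hP.2] at h
  have h' := mul_le_mul_of_nonneg_left h hn0.le
  simp only [negMulLog, mul_one, log_inv] at h'
  have e : n * n⁻¹ = 1 := mul_inv_cancel₀ hn0.ne'
  have e1 : n * (-n⁻¹ * -log n) = log n := by linear_combination (log n) * e
  rw [e1] at h'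
  unfold vecEntropy
  simp only [negMulLog]
  linear_combination h' - (∑ x, -P x * log (P x)) * e - (∑ x, P x ^ 2) / 2 * e + n⁻¹ / 2 * e

/-- Divergence from the uniform law is at most the chi-square distance: weight `log (n P) ≤ n P - 1`
by `P` and sum. -/
theorem entropy_deficit_le {F : Type*} [Fintype F] {P : F → ℝ} (hP : P ∈ stdSimplex ℝ F) :
    log (Fintype.card F) - vecEntropy P ≤ Fintype.card F * ∑ x, P x ^ 2 - 1 := by
  have : Nonempty F := by
    by_contra h
    rw [not_nonempty_iff] at h
    simpa using hP.2
  set n : ℝ := (Fintype.card F : ℝ) with hn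
  have hn0 : 0 < n := by rw [hn]; exact_mod_cast Fintype.card_pos
  have key : ∀ x, P x * log n - negMulLog (P x) ≤ n * P x ^ 2 - P x := by
    intro x
    rcases (hP.1 x).eq_or_lt with h | h
    · simp [← h]
    · have h1 := log_le_sub_one_of_pos (mul_pos hn0 h)
      rw [log_mul hn0.ne' h.ne'] at h1
      simp only [negMulLog]
      nlinarith
  have := sum_le_sum fun x (_ : x ∈ univ) => key x
  simp only [sum_sub_distrib, ← sum_mul, ← mul_sum, hP.2, one_mul] at this
  exact this

theorem inv_card_le_sum_sq {F : Type*} [Fintype F] {P : F → ℝ} (hP : P ∈ stdSimplex ℝ F) :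
    (Fintype.card F : ℝ)⁻¹ ≤ ∑ x, P x ^ 2 := by
  have h := sq_sum_le_card_mul_sum_sq (s := univ) (f := P)
  rw [hP.2, card_univ] at h
  rcases (Nat.cast_nonneg (α := ℝ) (Fintype.card F)).eq_or_lt with h0 | h0
  · rw [← h0] at h; norm_num at h
  · rw [inv_le_iff_one_le_mul₀' h0]; linarith

theorem vecEntropy_le_log_card {F : Type*} [Fintype F] {P : F → ℝ} (hP : P ∈ stdSimplex ℝ F) :
    vecEntropy P ≤ log (Fintype.card F) := by
  have h := sum_sq_sub_le_entropy_deficit hP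
  have h2 := inv_card_le_sum_sq hP
  linarith

/-- With `s = √x`, the bound `log s ≥ 1 - 1 / s` gives `negMulLog x ≤ 2 s (1 - s)`. The square is
needed: near `x = 0` the logarithm rules out a bound linear in `negMulLog x`. -/
theorem sq_negMulLog_le {x : ℝ} (h0 : 0 ≤ x) (h1 : x ≤ 1) :
    negMulLog x ^ 2 ≤ 4 * (x * (1 - x)) := by
  rcases h0.eq_or_lt with h | h
  · simp [← h]
  set s := √x with hs
  have hs0 : 0 < s := sqrt_pos.2 h
  have hx : x = s ^ 2 := (sq_sqrt h0).symm
  have hs1 : s ≤ 1 := by rw [hs]; exact sqrt_le_one.2 h1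
  have h2 : negMulLog x ≤ 2 * (s * (1 - s)) := by
    have := one_sub_inv_le_log_of_pos hs0
    have e : s * s⁻¹ = 1 := mul_inv_cancel₀ hs0.ne'
    rw [hx, negMulLog, log_pow]
    push_cast
    nlinarith [mul_le_mul_of_nonneg_left this (by positivity : 0 ≤ 2 * s ^ 2)]
  calc negMulLog x ^ 2 ≤ (2 * (s * (1 - s))) ^ 2 :=
        pow_le_pow_left₀ (negMulLog_nonneg h0 h1) h2 2
    _ ≤ 4 * (x * (1 - x)) := by
        rw [hx]
        nlinarith [mul_nonneg (mul_nonneg (sq_nonneg s) hs0.le) (sub_nonneg.2 hs1)]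

theorem sq_vecEntropy_le {F : Type*} [Fintype F] {P : F → ℝ} (hP : P ∈ stdSimplex ℝ F) :
    vecEntropy P ^ 2 ≤ 4 * Fintype.card F * (1 - ∑ x, P x ^ 2) := by
  have h := sq_sum_le_card_mul_sum_sq (s := univ) (f := fun x => negMulLog (P x))
  rw [card_univ] at h
  refine h.trans ?_
  have h2 : ∑ x, negMulLog (P x) ^ 2 ≤ 4 * (1 - ∑ x, P x ^ 2) := by
    rw [← hP.2, ← sum_sub_distrib, mul_sum]
    refine sum_le_sum fun x _ => (sq_negMulLog_le (hP.1 x)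
      (mem_Icc_of_mem_stdSimplex hP x).2).trans (le_of_eq (by ring))
  nlinarith [mul_le_mul_of_nonneg_left h2 (Nat.cast_nonneg (α := ℝ) (Fintype.card F))]

theorem one_sub_sum_sq_le_vecEntropy {F : Type*} [Fintype F] {P : F → ℝ}
    (hP : P ∈ stdSimplex ℝ F) : 1 - ∑ x, P x ^ 2 ≤ vecEntropy P := by
  rw [← hP.2, ← sum_sub_distrib]
  refine sum_le_sum fun x _ => ?_
  rcases (hP.1 x).eq_or_lt with h | h
  · simp [← h]
  · have := log_le_sub_one_of_pos h
    simp only [negMulLog]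
    nlinarith

/-! ### Entropy of convolutions on a finite abelian group -/

section Group

variable {G : Type*} [Fintype G] [AddCommGroup G]

theorem addConv_comm (P Q : G → ℝ) : addConv P Q = addConv Q P := by
  funext x
  unfold addConv
  rw [← Equiv.sum_comp (Equiv.subLeft x)]
  exact sum_congr rfl fun y _ => by simp [mul_comm]

theorem addConv_mem_stdSimplex {P Q : G → ℝ} (hP : P ∈ stdSimplex ℝ G)
    (hQ : Q ∈ stdSimplex ℝ G) : addConv P Q ∈ stdSimplex ℝ G := by
  refine ⟨fun x => sum_nonneg fun y _ => mul_nonneg (hP.1 _) (hQ.1 _), ?_⟩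
  unfold addConv
  rw [sum_comm]
  have : ∀ y, ∑ x, P (x - y) * Q y = Q y := by
    intro y
    have : ∑ x, P (x - y) = 1 := (Equiv.sum_comp (Equiv.subRight y) P).trans hP.2
    rw [← sum_mul, this, one_mul]
  simp [this, hQ.2]

theorem sum_comp_sub_right (y : G) (f : G → ℝ) : ∑ x, f (x - y) = ∑ x, f x :=
  Equiv.sum_comp (Equiv.subRight y) f

/-- The entropy deficit is, up to a constant, submultiplicative under convolution. -/
theorem entropy_deficit_addConv_le {P Q : G → ℝ} (hP : P ∈ stdSimplex ℝ G)
    (hQ : Q ∈ stdSimplex ℝ G) :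
    log (Fintype.card G) - vecEntropy (addConv P Q) ≤
      4 * (Fintype.card G : ℝ) ^ 2 * ((log (Fintype.card G) - vecEntropy P) *
        (log (Fintype.card G) - vecEntropy Q)) := by
  set n : ℝ := (Fintype.card G : ℝ) with hn
  have hn0 : 0 < n := by rw [hn]; exact_mod_cast Fintype.card_pos
  have e : n * n⁻¹ = 1 := mul_inv_cancel₀ hn0.ne'
  have hcard : ∑ _x : G, (1 : ℝ) = n := by simp [hn]
  have hvar : ∀ P ∈ stdSimplex ℝ G, ∑ x, (P x - n⁻¹) ^ 2 = ∑ x, P x ^ 2 - n⁻¹ := by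
    intro P hP
    have : ∀ x, (P x - n⁻¹) ^ 2 = P x ^ 2 - 2 * n⁻¹ * P x + n⁻¹ ^ 2 * 1 := fun x => by ring
    simp only [this, sum_add_distrib, sum_sub_distrib, ← mul_sum, hP.2, hcard]
    linear_combination n⁻¹ * e
  have hR := addConv_mem_stdSimplex hP hQ
  have hpt : ∀ x, (addConv P Q x - n⁻¹) ^ 2 ≤
      (∑ x, (P x - n⁻¹) ^ 2) * ∑ x, (Q x - n⁻¹) ^ 2 := by
    intro x
    -- Subtracting the uniform law commutes with convolution, so Cauchy–Schwarz can be applied to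
    -- the centred vectors; this is what makes the bound a product of two deficits.
    have h1 : addConv P Q x - n⁻¹ = ∑ y, (P (x - y) - n⁻¹) * (Q y - n⁻¹) := by
      have h2 : ∀ y, (P (x - y) - n⁻¹) * (Q y - n⁻¹) =
          P (x - y) * Q y - n⁻¹ * P (x - y) - n⁻¹ * Q y + n⁻¹ ^ 2 * 1 := fun y => by ring
      have h3 : ∑ y, P (x - y) = 1 := (Equiv.sum_comp (Equiv.subLeft x) P).trans hP.2
      simp only [h2, sum_add_distrib, sum_sub_distrib, ← mul_sum, hQ.2, h3, hcard]
      unfold addConv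
      linear_combination -n⁻¹ * e
    rw [h1]
    refine (sum_mul_sq_le_sq_mul_sq _ _ _).trans (le_of_eq ?_)
    congr 1
    exact Equiv.sum_comp (Equiv.subLeft x) fun y => (P y - n⁻¹) ^ 2
  have h1 := entropy_deficit_le hR
  rw [← hn] at h1
  have h2 : n * ∑ x, addConv P Q x ^ 2 - 1 = n * ∑ x, (addConv P Q x - n⁻¹) ^ 2 := by
    rw [hvar _ hR]; linear_combination e
  have h3 : ∑ x, (addConv P Q x - n⁻¹) ^ 2 ≤
      n * ((∑ x, (P x - n⁻¹) ^ 2) * ∑ x, (Q x - n⁻¹) ^ 2) := by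
    refine (sum_le_sum fun x _ => hpt x).trans (le_of_eq ?_)
    simp [hn]
  have hP' := sum_sq_sub_le_entropy_deficit hP
  have hQ' := sum_sq_sub_le_entropy_deficit hQ
  rw [← hn, ← hvar _ hP] at hP'
  rw [← hn, ← hvar _ hQ] at hQ'
  have hP0 : 0 ≤ ∑ x, (P x - n⁻¹) ^ 2 := sum_nonneg fun x _ => sq_nonneg _
  have hQ0 : 0 ≤ ∑ x, (Q x - n⁻¹) ^ 2 := sum_nonneg fun x _ => sq_nonneg _
  have h4 : (∑ x, (P x - n⁻¹) ^ 2) * ∑ x, (Q x - n⁻¹) ^ 2 ≤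
      (2 * (log n - vecEntropy P)) * (2 * (log n - vecEntropy Q)) :=
    mul_le_mul (by linarith) (by linarith) hQ0 (by linarith)
  calc log n - vecEntropy (addConv P Q) ≤ n * ∑ x, (addConv P Q x - n⁻¹) ^ 2 := h1.trans h2.le
    _ ≤ n * (n * ((2 * (log n - vecEntropy P)) * (2 * (log n - vecEntropy Q)))) := by
        gcongr; exact h3.trans (by gcongr)
    _ = _ := by ring

/-- Entropy gain of a convolution in terms of the distances between the translates of `P`. -/
theorem sum_sq_translates_le_vecEntropy_sub {P Q : G → ℝ} (hP : P ∈ stdSimplex ℝ G)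
    (hQ : Q ∈ stdSimplex ℝ G) :
    (∑ y, ∑ z, Q y * Q z * ∑ x, (P (x - y) - P (x - z)) ^ 2) / 4 ≤
      vecEntropy (addConv P Q) - vecEntropy P := by
  have h1 : ∀ x, _ := fun x => sum_mul_negMulLog_add_le (w := Q) (x := fun y => P (x - y)) hQ
    fun y => mem_Icc_of_mem_stdSimplex hP _
  have h2 := sum_le_sum fun x (_ : x ∈ univ) => h1 x
  rw [sum_add_distrib] at h2
  have h3 : ∑ x, ∑ y, Q y * negMulLog (P (x - y)) = vecEntropy P := by
    rw [sum_comm]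
    simp only [← mul_sum, sum_comp_sub_right _ fun x => negMulLog (P x)]
    rw [← sum_mul, hQ.2, one_mul]
    rfl
  -- A variance is half the mean squared difference of two independent draws; with the factor `1 /
  -- 2` from Jensen this gives `1 / 4`.
  have h4 : ∀ x, (∑ y, Q y * P (x - y) ^ 2 - (∑ y, Q y * P (x - y)) ^ 2) / 2 =
      (∑ y, ∑ z, Q y * Q z * (P (x - y) - P (x - z)) ^ 2) / 4 := by
    intro x
    have : ∀ y z, Q y * Q z * (P (x - y) - P (x - z)) ^ 2 = Q z * (Q y * P (x - y) ^ 2) +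
        Q y * (Q z * P (x - z) ^ 2) - 2 * (Q y * P (x - y)) * (Q z * P (x - z)) :=
      fun y z => by ring
    simp only [this, sum_add_distrib, sum_sub_distrib, ← mul_sum, ← sum_mul, hQ.2]
    ring
  simp only [h3, h4] at h2
  have h5 : vecEntropy (addConv P Q) = ∑ x, negMulLog (∑ y, Q y * P (x - y)) := by
    unfold vecEntropy addConv
    simp only [mul_comm]
  rw [← sum_div] at h2
  have h6 : ∑ y, ∑ z, Q y * Q z * ∑ x, (P (x - y) - P (x - z)) ^ 2 =
      ∑ x, ∑ y, ∑ z, Q y * Q z * (P (x - y) - P (x - z)) ^ 2 := by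
    simp only [mul_sum]
    rw [eq_comm, sum_comm]
    exact sum_congr rfl fun y _ => sum_comm
  rw [h5, h6]
  linarith

theorem vecEntropy_le_addConv {P Q : G → ℝ} (hP : P ∈ stdSimplex ℝ G)
    (hQ : Q ∈ stdSimplex ℝ G) : vecEntropy P ≤ vecEntropy (addConv P Q) := by
  have h := sum_sq_translates_le_vecEntropy_sub hP hQ
  have : 0 ≤ ∑ y, ∑ z, Q y * Q z * ∑ x, (P (x - y) - P (x - z)) ^ 2 :=
    sum_nonneg fun y _ => sum_nonneg fun z _ => mul_nonneg (mul_nonneg (hQ.1 _) (hQ.1 _))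
      (sum_nonneg fun x _ => sq_nonneg _)
  linarith

/-- Off the atom `a`, compare each mass with the constant `t` through `log (t / P x) ≤ t / P x - 1`;
the atom itself contributes at most `1 - P a`, which cancels the leftover `-P x` terms. Since `t` is
free, the same value can serve two vectors. -/
theorem vecEntropy_le_of_apply {F : Type*} [Fintype F] {P : F → ℝ} (hP : P ∈ stdSimplex ℝ F)
    (a : F) {t : ℝ} (ht : 0 < t) :
    vecEntropy P ≤ (1 - P a) * log t⁻¹ + Fintype.card F * t := by
  classical
  have key : ∀ x, negMulLog (P x) ≤ P x * log t⁻¹ + t - P x := by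
    intro x
    rcases (hP.1 x).eq_or_lt with h | h
    · simp [← h, ht.le]
    · have h1 := log_le_sub_one_of_pos (div_pos ht h)
      rw [log_div ht.ne' h.ne'] at h1
      have h2 : P x * (t / P x) = t := by field_simp
      rw [log_inv, negMulLog]
      nlinarith
  have h1 := sum_le_sum fun x (_ : x ∈ univ.erase a) => key x
  have h2 : vecEntropy P = negMulLog (P a) + ∑ x ∈ univ.erase a, negMulLog (P x) :=
    (add_sum_erase univ (fun x => negMulLog (P x)) (mem_univ a)).symm
  have h3 : P a + ∑ x ∈ univ.erase a, P x = 1 := (add_sum_erase univ P (mem_univ a)).trans hP.2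
  have h4 := negMulLog_le_one_sub_self (hP.1 a)
  have h5 : ∑ _x ∈ univ.erase a, t ≤ Fintype.card F * t := by
    rw [sum_const, nsmul_eq_mul]
    gcongr
    exact card_le_univ _
  rw [sum_sub_distrib, sum_add_distrib, ← sum_mul] at h1
  have h6 : ∑ x ∈ univ.erase a, P x = 1 - P a := by linarith
  rw [h6] at h1
  linarith

theorem exists_one_sub_apply_le_vecEntropy {F : Type*} [Fintype F] {P : F → ℝ}
    (hP : P ∈ stdSimplex ℝ F) : ∃ a, 1 - P a ≤ vecEntropy P := by
  have : Nonempty F := by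
    by_contra h
    rw [not_nonempty_iff] at h
    simpa using hP.2
  obtain ⟨a, ha⟩ := Finite.exists_max P
  refine ⟨a, le_trans ?_ (one_sub_sum_sq_le_vecEntropy hP)⟩
  have : ∑ x, P x ^ 2 ≤ ∑ x, P a * P x :=
    sum_le_sum fun x _ => by rw [sq]; exact mul_le_mul_of_nonneg_right (ha x) (hP.1 x)
  rw [← mul_sum, hP.2, mul_one] at this
  linarith

/-- A sum equal to `a + b` has either both summands at their atoms or neither. -/
theorem addConv_apply_add_le {P Q : G → ℝ} (hP : P ∈ stdSimplex ℝ G) (hQ : Q ∈ stdSimplex ℝ G)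
    (a b : G) : addConv P Q (a + b) ≤ P a * Q b + (1 - P a) * (1 - Q b) := by
  classical
  have h1 : addConv P Q (a + b) = P a * Q b + ∑ y ∈ univ.erase b, P (a + b - y) * Q y := by
    unfold addConv
    rw [← add_sum_erase univ _ (mem_univ b), add_sub_cancel_right]
  have h2 : ∀ y ∈ univ.erase b, P (a + b - y) * Q y ≤ (1 - P a) * Q y := by
    intro y hy
    refine mul_le_mul_of_nonneg_right ?_ (hQ.1 y)
    have hne : a + b - y ≠ a := by
      intro h
      rw [sub_eq_iff_eq_add, add_right_inj] at h
      exact ne_of_mem_erase hy h.symm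
    have := sum_le_sum_of_subset_of_nonneg (subset_univ ({a + b - y, a} : Finset G))
      fun x _ _ => hP.1 x
    rw [sum_pair hne, hP.2] at this
    linarith
  have h3 : Q b + ∑ x ∈ univ.erase b, Q x = 1 := (add_sum_erase univ Q (mem_univ b)).trans hQ.2
  have h4 := sum_le_sum h2
  rw [← mul_sum, show ∑ x ∈ univ.erase b, Q x = 1 - Q b by linarith] at h4
  linarith

theorem mul_le_addConv_apply_add {P Q : G → ℝ} (hP : P ∈ stdSimplex ℝ G)
    (hQ : Q ∈ stdSimplex ℝ G) (a b : G) : P a * Q b ≤ addConv P Q (a + b) := by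
  have := single_le_sum (f := fun y => P (a + b - y) * Q y)
    (fun y _ => mul_nonneg (hP.1 _) (hQ.1 _)) (mem_univ b)
  simpa [addConv] using this

/-- Away from `a + b` every mass of the convolution is at most `s`, so it contributes at least `log
s⁻¹` times itself, and the total mass there is at least `(1 - s) * s`. -/
theorem vecEntropy_addConv_ge {P Q : G → ℝ} (hP : P ∈ stdSimplex ℝ G) (hQ : Q ∈ stdSimplex ℝ G)
    (a b : G) {s : ℝ} (hs : s = (1 - P a) + (1 - Q b)) (hs0 : 0 < s) (hs1 : s ≤ 1) :
    (1 - s) * s * log s⁻¹ ≤ vecEntropy (addConv P Q) := by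
  classical
  set R := addConv P Q with hRdef
  have hR := addConv_mem_stdSimplex hP hQ
  rw [← hRdef] at hR
  have hup := addConv_apply_add_le hP hQ a b
  have hlo := mul_le_addConv_apply_add hP hQ a b
  rw [← hRdef] at hup hlo
  have hPa := mem_Icc_of_mem_stdSimplex hP a
  have hQb := mem_Icc_of_mem_stdSimplex hQ b
  have h3 : R (a + b) + ∑ x ∈ univ.erase (a + b), R x = 1 :=
    (add_sum_erase univ R (mem_univ _)).trans hR.2
  have hL : 0 ≤ log s⁻¹ := log_nonneg ((one_le_inv₀ hs0).2 hs1)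
  have h1 : ∑ x ∈ univ.erase (a + b), R x * log s⁻¹ ≤
      ∑ x ∈ univ.erase (a + b), negMulLog (R x) := by
    refine sum_le_sum fun x hx => ?_
    rcases (hR.1 x).eq_or_lt with h | h
    · simp [← h]
    · have hxs : R x ≤ s := by
        have := single_le_sum (f := R) (fun y _ => hR.1 y) hx
        nlinarith [mul_nonneg (sub_nonneg.2 hPa.2) (sub_nonneg.2 hQb.2)]
      have := log_le_log h hxs
      rw [negMulLog, log_inv]
      nlinarith
  have h2 : vecEntropy R = negMulLog (R (a + b)) + ∑ x ∈ univ.erase (a + b), negMulLog (R x) :=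
    (add_sum_erase univ (fun x => negMulLog (R x)) (mem_univ _)).symm
  have h4 := negMulLog_nonneg (hR.1 (a + b)) (mem_Icc_of_mem_stdSimplex hR _).2
  have h5 : (1 - s) * s ≤ 1 - R (a + b) := by
    subst hs
    nlinarith [sq_nonneg (1 - P a), sq_nonneg (1 - Q b)]
  rw [← sum_mul, show ∑ x ∈ univ.erase (a + b), R x = 1 - R (a + b) by linarith] at h1
  nlinarith [mul_le_mul_of_nonneg_right h5 hL]

variable (G) in
/-- The entropy of a convolution is almost additive for vectors of small entropy. -/
theorem exists_vecEntropy_add_le_addConv {ε : ℝ} (hε : 0 < ε) (hε1 : ε < 1) :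
    ∃ K : ℝ, 0 ≤ K ∧ ∀ P ∈ stdSimplex ℝ G, ∀ Q ∈ stdSimplex ℝ G,
      (1 - ε) * (vecEntropy P + vecEntropy Q) - K * (vecEntropy P * vecEntropy Q) ≤
        vecEntropy (addConv P Q) := by
  set n : ℝ := (Fintype.card G : ℝ) with hn
  -- When both entropies are below `t`, the off-atom mass `s` is at most `2 * t`. The first entry
  -- then gives `s ≤ ε / 2`, and the second makes `log s⁻¹` large enough to absorb the error `2 *
  -- n`.
  set t := min (ε / 4) (exp (-(4 * n / ε)) / 2) with ht
  have ht0 : 0 < t := by positivity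
  refine ⟨t⁻¹, by positivity, fun P hP Q hQ => ?_⟩
  have hP0 := vecEntropy_nonneg hP
  have hQ0 := vecEntropy_nonneg hQ
  have e : t⁻¹ * t = 1 := inv_mul_cancel₀ ht0.ne'
  have hti : 0 < t⁻¹ := by positivity
  -- If one entropy is at least `t`, the product term with `K = t⁻¹` already cancels the other
  -- entropy, and monotonicity under convolution suffices.
  rcases le_or_gt t (vecEntropy P) with h | hPt
  · have := vecEntropy_le_addConv hP hQ
    have h1 := mul_le_mul_of_nonneg_left h hti.le
    nlinarith
  rcases le_or_gt t (vecEntropy Q) with h | hQt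
  · have := vecEntropy_le_addConv hQ hP
    rw [addConv_comm] at this
    have h1 := mul_le_mul_of_nonneg_left h hti.le
    nlinarith
  obtain ⟨a, ha⟩ := exists_one_sub_apply_le_vecEntropy hP
  obtain ⟨b, hb⟩ := exists_one_sub_apply_le_vecEntropy hQ
  have hPa := mem_Icc_of_mem_stdSimplex hP a
  have hQb := mem_Icc_of_mem_stdSimplex hQ b
  have hR0 := vecEntropy_nonneg (addConv_mem_stdSimplex hP hQ)
  have hprod : 0 ≤ t⁻¹ * (vecEntropy P * vecEntropy Q) := by positivity
  rcases (add_nonneg (sub_nonneg.2 hPa.2) (sub_nonneg.2 hQb.2)).eq_or_lt with h0 | h0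
  · have hz : ∀ P ∈ stdSimplex ℝ G, ∀ a, 1 - P a = 0 → vecEntropy P ≤ 0 := by
      intro P hP a h
      refine le_of_forall_pos_le_add fun δ hδ => ?_
      have hn0 : 0 < n := by rw [hn]; exact_mod_cast Fintype.card_pos
      have := vecEntropy_le_of_apply hP a (div_pos hδ hn0)
      rw [h, ← hn, mul_div_cancel₀ _ hn0.ne'] at this
      linarith
    have h1 := hz P hP a (by linarith [hPa.2, hQb.2])
    have h2 := hz Q hQ b (by linarith [hPa.2, hQb.2])
    nlinarith
  set s := (1 - P a) + (1 - Q b) with hs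
  have hs2 : s ≤ 2 * t := by linarith
  have hsε : s ≤ ε / 2 := by linarith [min_le_left (ε / 4) (exp (-(4 * n / ε)) / 2)]
  have hsL : 4 * n / ε ≤ log s⁻¹ := by
    have : s ≤ exp (-(4 * n / ε)) := by
      linarith [min_le_right (ε / 4) (exp (-(4 * n / ε)) / 2)]
    have := log_le_log h0 this
    rw [log_exp] at this
    rw [log_inv]; linarith
  rw [div_le_iff₀ hε] at hsL
  have h1 := vecEntropy_addConv_ge hP hQ a b hs h0 (by linarith)
  have h2 := vecEntropy_le_of_apply hP a h0
  have h3 := vecEntropy_le_of_apply hQ b h0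
  rw [← hn] at h2 h3
  have hn0 : 0 ≤ n := by positivity
  have h4 : vecEntropy P + vecEntropy Q ≤ s * (log s⁻¹ + 2 * n) := by
    rw [hs] at *; linarith
  have h5 : (1 - ε) * (log s⁻¹ + 2 * n) ≤ (1 - s) * log s⁻¹ := by
    have hL : 0 ≤ log s⁻¹ := by
      by_contra! hc
      nlinarith
    nlinarith [mul_le_mul_of_nonneg_right hsε hL]
  have h6 := mul_le_mul_of_nonneg_left h4 (by linarith : 0 ≤ 1 - ε)
  have h7 := mul_le_mul_of_nonneg_left h5 h0.le
  nlinarith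

end Group

/-! ### Strict entropy gain on `ZMod q` -/

section Prime

variable {q : ℕ} [Fact q.Prime]

/-- A vector on `ZMod q` which is close to one of its nontrivial translates is close to being
constant. -/
theorem sum_sq_sub_le_translate (P : ZMod q → ℝ) (hP : P ∈ stdSimplex ℝ (ZMod q)) {d : ZMod q}
    (hd : d ≠ 0) :
    2 * (∑ x, P x ^ 2 - (q : ℝ)⁻¹) ≤ (q : ℝ) ^ 2 * ∑ x, (P (x + d) - P x) ^ 2 := by
  have hq : 0 < (q : ℝ) := by exact_mod_cast (Fact.out : q.Prime).pos
  set E := ∑ x, (P (x + d) - P x) ^ 2 with hE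
  have hE0 : 0 ≤ E := sum_nonneg fun x _ => sq_nonneg _
  have step : ∀ m : ℕ, ∑ x, (P (x + m * d) - P x) ^ 2 ≤ (m : ℝ) ^ 2 * E := by
    intro m
    have h1 : ∀ x, (P (x + m * d) - P x) ^ 2 ≤
        m * ∑ j ∈ range m, (P (x + j * d + d) - P (x + j * d)) ^ 2 := by
      intro x
      have h2 : P (x + m * d) - P x =
          ∑ j ∈ range m, (P (x + j * d + d) - P (x + j * d)) := by
        have := sum_range_sub (fun j : ℕ => P (x + j * d)) m
        simp only [Nat.cast_zero, zero_mul, add_zero] at this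
        rw [← this]
        refine sum_congr rfl fun j _ => ?_
        rw [add_assoc, Nat.cast_succ, add_mul, one_mul]
      rw [h2]
      have := sq_sum_le_card_mul_sum_sq (s := range m)
        (f := fun j => P (x + j * d + d) - P (x + j * d))
      rwa [card_range] at this
    refine (sum_le_sum fun x _ => h1 x).trans (le_of_eq ?_)
    rw [← mul_sum, sum_comm]
    have h3 : ∀ j : ℕ, ∑ x, (P (x + j * d + d) - P (x + j * d)) ^ 2 = E := fun j =>
      Equiv.sum_comp (Equiv.addRight ((j : ZMod q) * d)) fun x => (P (x + d) - P x) ^ 2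
    simp only [h3, sum_const, card_range, nsmul_eq_mul]
    ring
  -- Primality enters here: `d` is invertible, so every `c` is a multiple of `d` with multiplier
  -- below `q`.
  have all : ∀ c : ZMod q, ∑ x, (P (x + c) - P x) ^ 2 ≤ (q : ℝ) ^ 2 * E := by
    intro c
    have h := step (c * d⁻¹).val
    rw [ZMod.natCast_zmod_val, inv_mul_cancel_right₀ hd] at h
    refine h.trans ?_
    gcongr
    exact_mod_cast (ZMod.val_lt _).le
  have hsum := sum_le_sum fun c (_ : c ∈ univ) => all c
  have hcard : ∑ _x : ZMod q, (1 : ℝ) = q := by simp [ZMod.card]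
  have h4 : ∑ c : ZMod q, ∑ x, (P (x + c) - P x) ^ 2 = 2 * q * ∑ x, P x ^ 2 - 2 := by
    have h5 : ∀ x c, (P (x + c) - P x) ^ 2 =
        P (x + c) ^ 2 + P x ^ 2 * 1 - 2 * P x * P (x + c) := fun x c => by ring
    have h6 : ∀ x, ∑ c, P (x + c) ^ 2 = ∑ c, P c ^ 2 := fun x =>
      Equiv.sum_comp (Equiv.addLeft x) fun c => P c ^ 2
    have h7 : ∀ x, ∑ c, P (x + c) = 1 := fun x => (Equiv.sum_comp (Equiv.addLeft x) P).trans hP.2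
    rw [sum_comm]
    simp only [h5, sum_add_distrib, sum_sub_distrib, ← mul_sum, h6, h7, hP.2, hcard, ← sum_mul]
    simp [ZMod.card]
    ring
  rw [h4] at hsum
  simp only [sum_const, card_univ, ZMod.card, nsmul_eq_mul] at hsum
  have e : (q : ℝ) * (q : ℝ)⁻¹ = 1 := mul_inv_cancel₀ hq.ne'
  refine le_of_mul_le_mul_left ?_ hq
  linear_combination hsum - 2 * e

/-- Quantitative strict increase of entropy under convolution on `ZMod q`, for `q` prime. -/
theorem vecEntropy_addConv_gain {P Q : ZMod q → ℝ} (hP : P ∈ stdSimplex ℝ (ZMod q))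
    (hQ : Q ∈ stdSimplex ℝ (ZMod q)) :
    (log q - vecEntropy P) * vecEntropy Q ^ 2 ≤
      16 * (q : ℝ) ^ 4 * (vecEntropy (addConv P Q) - vecEntropy P) := by
  have hq : 0 < (q : ℝ) := by exact_mod_cast (Fact.out : q.Prime).pos
  have e : (q : ℝ) * (q : ℝ)⁻¹ = 1 := mul_inv_cancel₀ hq.ne'
  have h1 := sum_sq_translates_le_vecEntropy_sub hP hQ
  have h2 := entropy_deficit_le hP
  have h3 := sq_vecEntropy_le hQ
  have h0 := vecEntropy_le_log_card hP
  rw [ZMod.card] at h0 h2 h3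
  set S := ∑ x, P x ^ 2 - (q : ℝ)⁻¹ with hS
  -- Only pairs `y ≠ z` give distinct translates; their total `Q ⊗ Q` weight is `1 - ∑ Q ^ 2`, which
  -- controls `vecEntropy Q ^ 2`.
  have h4 : ∀ y z, Q y * Q z * (2 * S) - (if y = z then Q y ^ 2 * (2 * S) else 0) ≤
      (q : ℝ) ^ 2 * (Q y * Q z * ∑ x, (P (x - y) - P (x - z)) ^ 2) := by
    intro y z
    split_ifs with h
    · subst h; simp; nlinarith
    · have h5 := sum_sq_sub_le_translate P hP (d := z - y) (sub_ne_zero.2 (Ne.symm h))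
      have h6 : ∑ x, (P (x + (z - y)) - P x) ^ 2 = ∑ x, (P (x - y) - P (x - z)) ^ 2 := by
        rw [← sum_comp_sub_right z]
        refine sum_congr rfl fun x _ => ?_
        rw [sub_add_sub_cancel]
      rw [h6] at h5
      have := mul_le_mul_of_nonneg_left h5 (mul_nonneg (hQ.1 y) (hQ.1 z))
      linarith
  have h5 := sum_le_sum fun y (_ : y ∈ univ) => sum_le_sum fun z (_ : z ∈ univ) => h4 y z
  simp only [sum_sub_distrib, ← mul_sum, ← sum_mul, sum_ite_eq, mem_univ, if_true, hQ.2] at h5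
  have hgap : 0 ≤ 1 - ∑ x, Q x ^ 2 := by
    by_contra! hc
    nlinarith [sq_nonneg (vecEntropy Q)]
  have h2' : log q - vecEntropy P ≤ q * S := by rw [hS]; linear_combination h2 + e
  calc (log q - vecEntropy P) * vecEntropy Q ^ 2
      ≤ (q * S) * (4 * q * (1 - ∑ x, Q x ^ 2)) :=
        mul_le_mul h2' h3 (sq_nonneg _) (by linarith)
    _ ≤ 16 * (q : ℝ) ^ 4 * (vecEntropy (addConv P Q) - vecEntropy P) := by
        have h7 := mul_le_mul_of_nonneg_left h5 (by positivity : 0 ≤ 2 * (q : ℝ) ^ 2)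
        have h8 := mul_le_mul_of_nonneg_left h1 (by positivity : 0 ≤ 16 * (q : ℝ) ^ 4)
        have h9 : (q : ℝ) ^ 2 * (q : ℝ) ^ 2 = (q : ℝ) ^ 4 := by ring
        nlinarith [mul_nonneg hgap (sub_nonneg.2 h0)]

end Prime

end VecEntropy

/-! ### Conditional entropy of random variables on a discrete probability space -/

section MassEntropy

open Real Finset

variable {F : Type*} [Fintype F]

/-- The entropy of a finite mass vector, extended homogeneously from probability vectors. -/
noncomputable def massEntropy (w : F → ℝ) : ℝ := ∑ x, negMulLog (w x) - negMulLog (∑ x, w x)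

theorem massEntropy_smul (c : ℝ) (w : F → ℝ) :
    massEntropy (fun x => c * w x) = c * massEntropy w := by
  unfold massEntropy
  simp only [negMulLog_mul, sum_add_distrib, ← mul_sum, ← sum_mul]
  ring

theorem massEntropy_of_mem_stdSimplex {w : F → ℝ} (hw : w ∈ stdSimplex ℝ F) :
    massEntropy w = vecEntropy w := by
  simp [massEntropy, vecEntropy, hw.2]

theorem massEntropy_comp_equiv {G : Type*} [Fintype G] (e : F ≃ G) (w : G → ℝ) :
    massEntropy (fun x => w (e x)) = massEntropy w := by
  unfold massEntropy
  rw [Equiv.sum_comp e w, Equiv.sum_comp e fun x => negMulLog (w x)]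

/-- Gibbs' inequality. -/
theorem massEntropy_le_cross {w r : F → ℝ} (hw : ∀ x, 0 ≤ w x) (hr : ∀ x, 0 ≤ r x)
    (hwr : ∀ x, r x = 0 → w x = 0) :
    massEntropy w ≤ ∑ x, w x * (log (∑ x, r x) - log (r x)) := by
  set W := ∑ x, w x with hW
  set R := ∑ x, r x with hR
  have hR0 : 0 ≤ R := sum_nonneg fun x _ => hr x
  have key : ∀ x, negMulLog (w x) + w x * log W ≤
      w x * (log R - log (r x)) + (r x * W / R - w x) := by
    intro x
    rcases (hw x).eq_or_lt with h | h
    · have hW0 : 0 ≤ W := sum_nonneg fun x _ => hw x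
      simp only [← h, negMulLog_zero, zero_mul, zero_add, sub_zero]
      exact div_nonneg (mul_nonneg (hr x) hW0) hR0
    · have hrx : 0 < r x := (hr x).lt_of_ne fun h' => h.ne' (hwr x h'.symm)
      have hWx : 0 < W := h.trans_le (single_le_sum (fun y _ => hw y) (mem_univ x))
      have hRx : 0 < R := hrx.trans_le (single_le_sum (fun y _ => hr y) (mem_univ x))
      -- The comparison vector is `r` rescaled to total mass `W`, so the linear error terms cancel
      -- on summation.
      have h1 := log_le_sub_one_of_pos (div_pos (div_pos (mul_pos hrx hWx) hRx) h)
      rw [log_div (by positivity) h.ne', log_div (by positivity) hRx.ne',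
        log_mul hrx.ne' hWx.ne'] at h1
      have h2 := mul_le_mul_of_nonneg_left h1 h.le
      have e : w x * (r x * W / R / w x - 1) = r x * W / R - w x := by
        rw [mul_sub, mul_div_cancel₀ _ h.ne', mul_one]
      rw [e] at h2
      simp only [negMulLog]
      linarith
  have h := sum_le_sum fun x (_ : x ∈ univ) => key x
  have hz : ∑ x, r x * W / R - W ≤ 0 := by
    rw [← sum_div, ← sum_mul, ← hR]
    rcases hR0.eq_or_lt with h0 | h0
    · have : W = 0 := sum_eq_zero fun x _ => hwr x <|
        (sum_eq_zero_iff_of_nonneg fun x _ => hr x).1 h0.symm x (mem_univ x)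
      simp [this]
    · rw [mul_div_cancel_left₀ _ h0.ne', sub_self]
  rw [sum_add_distrib, sum_add_distrib, sum_sub_distrib, ← sum_mul, ← hW] at h
  unfold massEntropy
  rw [← hW, negMulLog]
  linarith

theorem massEntropy_nonneg {w : F → ℝ} (hw : ∀ x, 0 ≤ w x) : 0 ≤ massEntropy w := by
  unfold massEntropy
  rw [sub_nonneg]
  simp only [negMulLog]
  rw [← sum_neg_distrib, sum_mul]
  refine sum_le_sum fun x _ => ?_
  rcases (hw x).eq_or_lt with h | h
  · simp [← h]
  · have := log_le_log h (single_le_sum (fun y _ => hw y) (mem_univ x))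
    nlinarith

theorem massEntropy_le_log_card {w : F → ℝ} (hw : ∀ x, 0 ≤ w x) :
    massEntropy w ≤ (∑ x, w x) * log (Fintype.card F) := by
  have := massEntropy_le_cross (r := fun _ => 1) hw (fun _ => zero_le_one) (by simp)
  simpa [sum_mul] using this

theorem massEntropy_eq_mul {w : F → ℝ} (hw : ∀ x, 0 ≤ w x) :
    massEntropy w = (∑ x, w x) * ∑ x, negMulLog (w x / ∑ x, w x) := by
  set W := ∑ x, w x with hW
  rcases (sum_nonneg fun x (_ : x ∈ univ) => hw x).eq_or_lt with h | h
  · have : ∀ x, w x = 0 := fun x =>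
      (sum_eq_zero_iff_of_nonneg fun x _ => hw x).1 h.symm x (mem_univ x)
    simp [massEntropy, this, hW]
  · rw [← hW] at h
    have h1 : massEntropy w = W * massEntropy fun x => w x / W := by
      rw [← massEntropy_smul]
      congr 1
      funext x
      rw [mul_div_cancel₀ _ h.ne']
    rw [h1, massEntropy_of_mem_stdSimplex]
    · rfl
    · exact ⟨fun x => div_nonneg (hw x) h.le, by rw [← sum_div, ← hW, div_self h.ne']⟩

theorem massEntropy_pi_single [DecidableEq F] (a : F) (c : ℝ) :
    massEntropy (fun x => if x = a then c else 0) = 0 := by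
  simp [massEntropy, apply_ite negMulLog]

end MassEntropy

/-! ### Pushforwards of discrete laws -/

section PMFLemmas

variable {α β γ : Type*}

theorem PMF.tsum_map_mul (p : PMF α) (f : α → β) (g : β → ℝ≥0∞) :
    ∑' b, p.map f b * g b = ∑' a, p a * g (f a) := by
  classical
  simp only [PMF.map_apply, ← ENNReal.tsum_mul_right]
  rw [ENNReal.tsum_comm]
  refine tsum_congr fun a => ?_
  rw [tsum_eq_single (f a) fun b hb => by simp [hb]]
  simp

theorem PMF.map_apply_of_injective (p : PMF α) {f : α → β} (hf : Function.Injective f) (a : α) :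
    p.map f (f a) = p a := by
  classical
  rw [PMF.map_apply, tsum_eq_single a fun b hb => by simp [hf.ne hb.symm]]
  simp

theorem PMF.map_comp_apply_of_injective (p : PMF α) (f : α → β) {g : β → γ}
    (hg : Function.Injective g) (b : β) : p.map (fun a => g (f a)) (g b) = p.map f b := by
  rw [← PMF.map_apply_of_injective (p.map f) hg, PMF.map_comp]
  rfl

theorem PMF.sum_map_prod_apply {F : Type*} [Fintype F] (p : PMF α) (u : α → F) (s : α → β)
    (b : β) : ∑ x, p.map (fun z => (u z, s z)) (x, b) = p.map s b := by
  classical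
  have : p.map s = (p.map fun z => (u z, s z)).map Prod.snd := by rw [PMF.map_comp]; rfl
  rw [this, PMF.map_apply, ENNReal.tsum_prod', tsum_fintype]
  refine Finset.sum_congr rfl fun x _ => ?_
  rw [tsum_eq_single b fun c hc => by simp [hc.symm]]
  simp

theorem PMF.sum_toReal_map_prod {F : Type*} [Fintype F] (p : PMF α) (u : α → F) (s : α → β)
    (b : β) : ∑ x, (p.map (fun z => (u z, s z)) (x, b)).toReal = (p.map s b).toReal := by
  rw [← PMF.sum_map_prod_apply p u s, ENNReal.toReal_sum fun x _ => PMF.apply_ne_top _ _]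

end PMFLemmas

/-! ### Conditional entropy: chain rule, monotonicity, independence -/

section CondEnt

open Real

variable {α β F F' S T : Type*}

/-- The vector of masses of the events `u = x`, `s = a`. -/
noncomputable def fiberMass (p : PMF α) (u : α → F) (s : α → S) (a : S) (x : F) : ℝ :=
  (p.map (fun z => (u z, s z)) (x, a)).toReal

theorem fiberMass_nonneg (p : PMF α) (u : α → F) (s : α → S) (a : S) (x : F) :
    0 ≤ fiberMass p u s a x := ENNReal.toReal_nonneg

theorem ofReal_fiberMass_mul (p : PMF α) (u : α → F) (s : α → S) (a : S) (x : F) (y : ℝ) :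
    ENNReal.ofReal (fiberMass p u s a x * y) =
      p.map (fun z => (u z, s z)) (x, a) * ENNReal.ofReal y := by
  rw [ENNReal.ofReal_mul (fiberMass_nonneg p u s a x), fiberMass,
    ENNReal.ofReal_toReal (PMF.apply_ne_top _ _)]

variable [Fintype F] [Fintype F']

/-- The conditional entropy `H(u | s)`, in nats, of random variables on the discrete probability
space `(α, p)`. -/
noncomputable def condEnt (p : PMF α) (u : α → F) (s : α → S) : ℝ≥0∞ :=
  ∑' a, ENNReal.ofReal (massEntropy (fiberMass p u s a))

theorem sum_fiberMass (p : PMF α) (u : α → F) (s : α → S) (a : S) :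
    ∑ x, fiberMass p u s a x = (p.map s a).toReal := PMF.sum_toReal_map_prod p u s a

theorem condEnt_map (p : PMF α) (f : α → β) (u : β → F) (s : β → S) :
    condEnt (p.map f) u s = condEnt p (fun z => u (f z)) fun z => s (f z) := by
  unfold condEnt fiberMass
  rw [PMF.map_comp]
  rfl

theorem condEnt_le_log_card (p : PMF α) (u : α → F) (s : α → S) :
    condEnt p u s ≤ ENNReal.ofReal (log (Fintype.card F)) := by
  have hcard : 0 ≤ log (Fintype.card F) := by
    rcases Nat.eq_zero_or_pos (Fintype.card F) with h | h
    · simp [h]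
    · exact log_nonneg (by exact_mod_cast h)
  calc condEnt p u s ≤ ∑' a, p.map s a * ENNReal.ofReal (log (Fintype.card F)) := by
        refine ENNReal.tsum_le_tsum fun a => ?_
        rw [← ENNReal.ofReal_toReal (PMF.apply_ne_top (p.map s) a), ← sum_fiberMass p u s a,
          ← ENNReal.ofReal_mul (Finset.sum_nonneg fun x _ => fiberMass_nonneg p u s a x)]
        exact ENNReal.ofReal_le_ofReal (massEntropy_le_log_card (fiberMass_nonneg p u s a))
    _ = ENNReal.ofReal (log (Fintype.card F)) := by
        rw [ENNReal.tsum_mul_right, PMF.tsum_coe, one_mul]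

theorem condEnt_ne_top (p : PMF α) (u : α → F) (s : α → S) : condEnt p u s ≠ ⊤ :=
  ne_top_of_le_ne_top ENNReal.ofReal_ne_top (condEnt_le_log_card p u s)

/-- The chain rule. -/
theorem condEnt_prodMk (p : PMF α) (u : α → F) (v : α → F') (s : α → S) :
    condEnt p (fun z => (u z, v z)) s = condEnt p v s + condEnt p u fun z => (v z, s z) := by
  unfold condEnt
  rw [ENNReal.tsum_prod', ENNReal.tsum_comm, ← ENNReal.tsum_add]
  refine tsum_congr fun a => ?_
  have h1 : ∀ x y, fiberMass p (fun z => (u z, v z)) s a (x, y) =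
      fiberMass p u (fun z => (v z, s z)) (y, a) x := by
    intro x y
    unfold fiberMass
    congr 1
    exact (PMF.map_comp_apply_of_injective p (fun z => (u z, (v z, s z)))
      (g := fun t : F × F' × S => ((t.1, t.2.1), t.2.2))
      (fun t t' h => by simp_all [Prod.ext_iff]) (x, (y, a)))
  have h2 : ∀ y, ∑ x, fiberMass p u (fun z => (v z, s z)) (y, a) x = fiberMass p v s a y :=
    fun y => sum_fiberMass p u (fun z => (v z, s z)) (y, a)
  rw [tsum_fintype, ← ENNReal.ofReal_sum_of_nonneg fun y _ =>
      massEntropy_nonneg (fiberMass_nonneg p u _ (y, a)),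
    ← ENNReal.ofReal_add (massEntropy_nonneg (fiberMass_nonneg p v s a))
      (Finset.sum_nonneg fun y _ => massEntropy_nonneg (fiberMass_nonneg p u _ (y, a)))]
  congr 1
  unfold massEntropy
  rw [Fintype.sum_prod_type_right, Fintype.sum_prod_type_right]
  simp only [h1, h2, Finset.sum_sub_distrib]
  ring

theorem condEnt_eq_zero_of_factors (p : PMF α) {u : α → F} {s : α → S}
    (h : ∀ z z', s z = s z' → u z = u z') : condEnt p u s = 0 := by
  classical
  obtain ⟨z₀, -⟩ := p.support_nonempty
  have : Nonempty F := ⟨u z₀⟩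
  obtain ⟨φ, hφ⟩ : ∃ φ : S → F, u = φ ∘ s :=
    (Function.factorsThrough_iff u).1 fun z z' hz => h z z' hz
  refine ENNReal.tsum_eq_zero.2 fun a => ?_
  have : fiberMass p u s a = fun x => if x = φ a then (p.map s a).toReal else 0 := by
    funext x
    unfold fiberMass
    split_ifs with hx
    · subst hx
      rw [← PMF.map_comp_apply_of_injective p s (g := fun a => (φ a, a))
        (fun a b hab => by simp_all [Prod.ext_iff])]
      simp [hφ]
    · rw [PMF.map_apply, ENNReal.tsum_eq_zero.2, ENNReal.toReal_zero]
      intro z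
      rw [if_neg]
      intro hz
      simp only [hφ, Function.comp, Prod.mk.injEq] at hz
      exact hx (by rw [hz.1, hz.2])
  rw [this, massEntropy_pi_single, ENNReal.ofReal_zero]

/-- Conditioning on a function of `s` gives at least as much entropy as conditioning on `s`. -/
theorem condEnt_le_comp (p : PMF α) (u : α → F) (s : α → S) (φ : S → T) :
    condEnt p u s ≤ condEnt p u fun z => φ (s z) := by
  set r := fiberMass p u (fun z => φ (s z)) with hr
  set ℓ : F → T → ℝ := fun x b => log (∑ x, r b x) - log (r b x) with hℓ
  have hwr : ∀ a x, r (φ a) x = 0 → fiberMass p u s a x = 0 := by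
    classical
    intro a x h
    unfold fiberMass at *
    simp only [hr, ENNReal.toReal_eq_zero_iff, PMF.apply_ne_top, or_false] at h ⊢
    rw [PMF.map_apply, ENNReal.tsum_eq_zero] at h ⊢
    intro z
    specialize h z
    split_ifs with hz
    · rw [Prod.mk.injEq] at hz
      rwa [if_pos (by rw [hz.1, hz.2])] at h
    · rfl
  have hℓ0 : ∀ x b, 0 < r b x → 0 ≤ ℓ x b := fun x b h => sub_nonneg.2 <| log_le_log h <|
    Finset.single_le_sum (fun y _ => fiberMass_nonneg p u _ b y) (Finset.mem_univ x)
  have hterm : ∀ b x, 0 ≤ r b x * ℓ x b := by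
    intro b x
    rcases (fiberMass_nonneg p u (fun z => φ (s z)) b x).eq_or_lt with h | h
    · rw [hr, ← h, zero_mul]
    · exact mul_nonneg h.le (hℓ0 x b h)
  have hterm' : ∀ a x, 0 ≤ fiberMass p u s a x * ℓ x (φ a) := by
    intro a x
    rcases (fiberMass_nonneg p u (fun z => φ (s z)) (φ a) x).eq_or_lt with h | h
    · rw [hwr a x h.symm, zero_mul]
    · exact mul_nonneg (fiberMass_nonneg p u s a x) (hℓ0 x _ h)
  -- Gibbs' inequality on each fibre of `s` is applied with the coarser fibre of `φ ∘ s` as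
  -- reference. The resulting integrand depends on `s` only through `φ ∘ s`, so its expectation is
  -- the entropy on the right.
  calc condEnt p u s
      ≤ ∑' a, ENNReal.ofReal (∑ x, fiberMass p u s a x * ℓ x (φ a)) :=
        ENNReal.tsum_le_tsum fun a => ENNReal.ofReal_le_ofReal <|
          massEntropy_le_cross (fiberMass_nonneg p u s a) (fiberMass_nonneg p u _ (φ a)) (hwr a)
    _ = ∑' y : F × S, p.map (fun z => (u z, s z)) y * ENNReal.ofReal (ℓ y.1 (φ y.2)) := by
        rw [ENNReal.tsum_prod', ENNReal.tsum_comm]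
        refine tsum_congr fun a => ?_
        rw [tsum_fintype, ENNReal.ofReal_sum_of_nonneg fun x _ => hterm' a x]
        exact Finset.sum_congr rfl fun x _ => ofReal_fiberMass_mul p u s a x _
    _ = ∑' y : F × T, p.map (fun z => (u z, φ (s z))) y * ENNReal.ofReal (ℓ y.1 y.2) := by
        rw [PMF.tsum_map_mul p (fun z => (u z, s z)) fun y => ENNReal.ofReal (ℓ y.1 (φ y.2)),
          PMF.tsum_map_mul p (fun z => (u z, φ (s z))) fun y => ENNReal.ofReal (ℓ y.1 y.2)]
    _ = ∑' b, ENNReal.ofReal (∑ x, r b x * ℓ x b) := by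
        rw [ENNReal.tsum_prod', ENNReal.tsum_comm]
        refine tsum_congr fun b => ?_
        rw [tsum_fintype, ENNReal.ofReal_sum_of_nonneg fun x _ => hterm b x]
        exact Finset.sum_congr rfl fun x _ =>
          (ofReal_fiberMass_mul p u (fun z => φ (s z)) b x _).symm
    _ = condEnt p u fun z => φ (s z) := by
        refine tsum_congr fun b => ?_
        congr 1
        simp only [hℓ, massEntropy, mul_sub, Finset.sum_sub_distrib, ← Finset.sum_mul, negMulLog,
          neg_mul, Finset.sum_neg_distrib]
        rw [hr]
        ring

/-- If `s'` is a function of `s`, and `u` is a function of `(u', s)`, then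
`H(u | s) ≤ H(u' | s')`. -/
theorem condEnt_le_of_factors (p : PMF α) {u : α → F} {u' : α → F'} {s : α → S} {s' : α → T}
    (hs : ∀ z z', s z = s z' → s' z = s' z')
    (hu : ∀ z z', s z = s z' → u' z = u' z' → u z = u z') :
    condEnt p u s ≤ condEnt p u' s' := by
  obtain ⟨z₀, -⟩ := p.support_nonempty
  have : Nonempty T := ⟨s' z₀⟩
  obtain ⟨φ, hφ⟩ : ∃ φ : S → T, s' = φ ∘ s :=
    (Function.factorsThrough_iff s').1 fun z z' hz => hs z z' hz
  calc condEnt p u s ≤ condEnt p (fun z => (u' z, u z)) s := by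
        rw [condEnt_prodMk]; exact le_self_add
    _ = condEnt p (fun z => (u z, u' z)) s := by
        unfold condEnt
        refine tsum_congr fun a => ?_
        rw [← massEntropy_comp_equiv (Equiv.prodComm F F')]
        congr 2
        funext x
        exact congrArg ENNReal.toReal (PMF.map_comp_apply_of_injective p
          (fun z => ((u z, u' z), s z)) (g := fun t : (F × F') × S => (t.1.swap, t.2))
          (fun t t' h => by simp_all [Prod.ext_iff]) (x, a))
    _ = condEnt p u' s := by
        rw [condEnt_prodMk, condEnt_eq_zero_of_factors (u := u), add_zero]
        intro z z' h
        rw [Prod.mk.injEq] at h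
        exact hu z z' h.2 h.1
    _ ≤ condEnt p u' s' := hφ ▸ condEnt_le_comp p u' s φ

/-- Conditional entropy sees only the partitions induced by the variables. This allows recoding of
tuples and linear changes of variables without explicit bijections. -/
theorem condEnt_congr (p : PMF α) {u : α → F} {u' : α → F'} {s : α → S} {s' : α → T}
    (hs : ∀ z z', s z = s z' ↔ s' z = s' z')
    (hu : ∀ z z', s z = s z' → (u z = u z' ↔ u' z = u' z')) :
    condEnt p u s = condEnt p u' s' :=
  le_antisymm (condEnt_le_of_factors p (fun z z' => (hs z z').1) fun z z' h => (hu z z' h).2)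
    (condEnt_le_of_factors p (fun z z' => (hs z z').2) fun z z' h => (hu z z' ((hs z z').2 h)).1)

/-- Independence of two discrete random variables. -/
def PMFIndep (p : PMF α) (f : α → S) (g : α → T) : Prop :=
  p.map (fun z => (f z, g z)) = (p.map f).bind fun b => (p.map g).map fun c => (b, c)

theorem PMF.bind_map_prodMk_apply (p : PMF S) (r : PMF T) (b : S) (c : T) :
    (p.bind fun b => r.map fun c => (b, c)) (b, c) = p b * r c := by
  classical
  rw [PMF.bind_apply, tsum_eq_single b]
  · rw [PMF.map_apply_of_injective r (f := fun c => (b, c)) fun c c' h => by simpa using h]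
  · intro b' hb
    rw [PMF.map_apply, ENNReal.tsum_eq_zero.2 fun c' => by simp [hb.symm], mul_zero]

theorem PMFIndep.apply {p : PMF α} {f : α → S} {g : α → T} (h : PMFIndep p f g) (b : S) (c : T) :
    p.map (fun z => (f z, g z)) (b, c) = p.map f b * p.map g c := by
  rw [h, PMF.bind_map_prodMk_apply]

theorem PMFIndep.comp {S' T' : Type*} {p : PMF α} {f : α → S} {g : α → T} (h : PMFIndep p f g)
    (φ : S → S') (ψ : T → T') : PMFIndep p (fun z => φ (f z)) fun z => ψ (g z) := by
  have h1 := congrArg (PMF.map (Prod.map φ ψ)) h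
  unfold PMFIndep
  rw [PMF.map_comp, PMF.map_bind] at h1
  simp only [PMF.map_comp] at h1
  refine h1.trans ?_
  have h2 : p.map (fun z => φ (f z)) = (p.map f).map φ := by rw [PMF.map_comp]; rfl
  have h3 : p.map (fun z => ψ (g z)) = (p.map g).map ψ := by rw [PMF.map_comp]; rfl
  rw [h2, h3, PMF.bind_map (p.map f) φ]
  congr 1
  funext b
  simp only [PMF.map_comp, Function.comp_apply]
  rfl

/-- Random variables independent of `(u, s)` may be dropped from the conditioning. -/
theorem condEnt_prodMk_of_indep {p : PMF α} {u : α → F} {s : α → S} {t : α → T}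
    (h : PMFIndep p (fun z => (u z, s z)) t) :
    (condEnt p u fun z => (s z, t z)) = condEnt p u s := by
  unfold condEnt
  have h1 : ∀ a c, fiberMass p u (fun z => (s z, t z)) (a, c) =
      fun x => (p.map t c).toReal * fiberMass p u s a x := by
    intro a c
    funext x
    unfold fiberMass
    rw [← ENNReal.toReal_mul, mul_comm, ← h.apply]
    exact congrArg ENNReal.toReal (PMF.map_comp_apply_of_injective p
      (fun z => ((u z, s z), t z)) (g := fun y : (F × S) × T => (y.1.1, (y.1.2, y.2)))
      (fun y y' h => by simp_all [Prod.ext_iff]) ((x, a), c))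
  rw [ENNReal.tsum_prod']
  refine tsum_congr fun a => ?_
  simp only [h1, massEntropy_smul, ENNReal.ofReal_mul ENNReal.toReal_nonneg,
    ENNReal.ofReal_toReal (PMF.apply_ne_top _ _)]
  rw [ENNReal.tsum_mul_right, PMF.tsum_coe, one_mul]

/-- The chain rule for a tuple. -/
theorem condEnt_pi_eq_sum (p : PMF α) (s : α → S) {n : ℕ} (V : α → Fin n → F) :
    condEnt p V s = ∑ l, condEnt p (fun z => V z l)
      fun z => ((fun i : {i : Fin n // i < l} => V z i), s z) := by
  induction n with
  | zero =>
    rw [Fin.sum_univ_zero]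
    exact condEnt_eq_zero_of_factors p fun z z' _ => Subsingleton.elim _ _
  | succ n ih =>
    have h1 : condEnt p V s =
        condEnt p (fun z => (V z (Fin.last n), fun i : Fin n => V z i.castSucc)) s := by
      refine condEnt_congr p (fun _ _ => Iff.rfl) fun z z' _ => ⟨fun h => by rw [h], fun h => ?_⟩
      rw [Prod.mk.injEq, funext_iff] at h
      exact funext fun i => Fin.lastCases h.1 h.2 i
    rw [h1, condEnt_prodMk, ih, Fin.sum_univ_castSucc]
    congr 1
    · refine Finset.sum_congr rfl fun l _ => condEnt_congr p (fun z z' => ?_) fun _ _ _ => Iff.rfl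
      simp only [Prod.mk.injEq, funext_iff, Subtype.forall]
      refine and_congr_left fun _ => ⟨fun h i hi => ?_, fun h i hi => h _ (by simpa using hi)⟩
      have hlt : (i : ℕ) < n := (Fin.lt_def.1 hi).trans l.2
      exact h ⟨i, hlt⟩ hi
    · refine condEnt_congr p (fun z z' => ?_) fun _ _ _ => Iff.rfl
      simp only [Prod.mk.injEq, funext_iff, Subtype.forall]
      refine and_congr_left fun _ => ⟨fun h i hi => ?_, fun h i => h _ (Fin.castSucc_lt_last i)⟩
      exact h ⟨i, hi⟩

theorem condEntropy_map {q : ℕ} [NeZero q] {S : Type*} (p : PMF α) (u : α → ZMod q) (s : α → S) :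
    condEntropy (p.map fun z => (u z, s z)) = (condEnt p u s).toReal / log q := by
  unfold condEntropy condEnt
  rw [ENNReal.tsum_toReal_eq fun a => ENNReal.ofReal_ne_top]
  congr 1
  refine tsum_congr fun a => ?_
  rw [ENNReal.toReal_ofReal (massEntropy_nonneg (fiberMass_nonneg p u s a)),
    massEntropy_eq_mul (fiberMass_nonneg p u s a), sum_fiberMass, PMF.map_comp]
  rfl

theorem condEntropy_eq {q : ℕ} [NeZero q] {S : Type*} (p : PMF (ZMod q × S)) :
    condEntropy p = (condEnt p Prod.fst Prod.snd).toReal / log q := by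
  rw [← condEntropy_map]
  exact congrArg _ p.map_id.symm

theorem condEntropy_mem_Icc {q : ℕ} [NeZero q] {S : Type*} (p : PMF (ZMod q × S)) :
    condEntropy p ∈ Set.Icc (0 : ℝ) 1 := by
  have h0 : 0 ≤ log q := log_nonneg (by exact_mod_cast NeZero.one_le)
  rw [condEntropy_eq]
  refine ⟨div_nonneg ENNReal.toReal_nonneg h0, div_le_one_of_le₀ ?_ h0⟩
  have h := condEnt_le_log_card p (Prod.fst : _ → ZMod q) Prod.snd
  rw [ZMod.card] at h
  exact ENNReal.toReal_le_of_le_ofReal h0 h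

end CondEnt

/-! ### Sums of independent random variables -/

section IndepSum

open Real

variable {α F S T G : Type*}

theorem hasSum_condEnt [Fintype F] (p : PMF α) (u : α → F) (s : α → S) :
    HasSum (fun a => massEntropy (fiberMass p u s a)) (condEnt p u s).toReal := by
  have h := ENNReal.hasSum_toReal (condEnt_ne_top p u s)
  rw [← ENNReal.tsum_toReal_eq fun a => ENNReal.ofReal_ne_top] at h
  simp only [ENNReal.toReal_ofReal (massEntropy_nonneg (fiberMass_nonneg p u s _))] at h
  exact h

theorem PMF.hasSum_toReal (p : PMF α) : HasSum (fun a => (p a).toReal) 1 := by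
  have h := ENNReal.hasSum_toReal (f := p) (by rw [PMF.tsum_coe]; exact ENNReal.one_ne_top)
  rwa [← ENNReal.tsum_toReal_eq fun a => PMF.apply_ne_top p a, PMF.tsum_coe,
    ENNReal.toReal_one] at h

theorem addConv_smul_smul [Fintype G] [AddCommGroup G] (c d : ℝ) (P Q : G → ℝ) :
    addConv (fun x => c * P x) (fun x => d * Q x) = fun x => c * d * addConv P Q x := by
  funext x
  simp only [addConv, Finset.mul_sum]
  exact Finset.sum_congr rfl fun y _ => by ring

theorem fiberMass_add_of_indep [Fintype G] [AddCommGroup G] {p : PMF α} {u₁ u₂ : α → G}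
    {s₁ : α → S} {s₂ : α → T} (h : PMFIndep p (fun z => (u₁ z, s₁ z)) fun z => (u₂ z, s₂ z))
    (a₁ : S) (a₂ : T) :
    fiberMass p (fun z => u₁ z + u₂ z) (fun z => (s₁ z, s₂ z)) (a₁, a₂) =
      addConv (fiberMass p u₁ s₁ a₁) (fiberMass p u₂ s₂ a₂) := by
  funext x
  unfold addConv
  rw [fiberMass, ← PMF.sum_toReal_map_prod p u₂]
  refine Finset.sum_congr rfl fun y _ => ?_
  rw [fiberMass, fiberMass, ← ENNReal.toReal_mul, ← h.apply]
  have := PMF.map_comp_apply_of_injective p (fun z => ((u₁ z, s₁ z), (u₂ z, s₂ z)))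
    (g := fun t : (G × S) × G × T => (t.2.1, (t.1.1 + t.2.1, (t.1.2, t.2.2))))
    (fun t t' h => by
      simp only [Prod.mk.injEq] at h
      obtain ⟨h1, h2, h3, h4⟩ := h
      rw [h1, add_left_inj] at h2
      exact Prod.ext (Prod.ext h2 h3) (Prod.ext h1 h4)) ((x - y, a₁), (y, a₂))
  rw [← this]
  simp

theorem exists_eq_smul_of_fiberMass [Fintype F] (p : PMF α) (u : α → F) (s : α → S) (a : S)
    (ha : (p.map s a).toReal ≠ 0) :
    ∃ P ∈ stdSimplex ℝ F, fiberMass p u s a = fun x => (p.map s a).toReal * P x := by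
  refine ⟨fun x => fiberMass p u s a x / (p.map s a).toReal, ⟨fun x =>
    div_nonneg (fiberMass_nonneg p u s a x) ENNReal.toReal_nonneg, ?_⟩, ?_⟩
  · rw [← Finset.sum_div, sum_fiberMass, div_self ha]
  · funext x
    rw [mul_div_cancel₀ _ ha]

theorem massEntropy_fiberMass_of_eq_zero [Fintype F] (p : PMF α) (u : α → F) (s : α → S) (a : S)
    (ha : (p.map s a).toReal = 0) : massEntropy (fiberMass p u s a) = 0 := by
  refine le_antisymm ?_ (massEntropy_nonneg (fiberMass_nonneg p u s a))
  have := massEntropy_le_log_card (fiberMass_nonneg p u s a)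
  rwa [sum_fiberMass, ha, zero_mul] at this

/-- A bilinear lower bound for the entropy of convolutions of probability vectors carries over to
conditional entropies of sums of independent random variables. -/
theorem bilinear_le_condEnt_add [Fintype G] [AddCommGroup G] {c₀ c₁ c₂ c₃ : ℝ}
    (hc : ∀ P ∈ stdSimplex ℝ G, ∀ Q ∈ stdSimplex ℝ G,
      c₀ + c₁ * vecEntropy P + c₂ * vecEntropy Q + c₃ * (vecEntropy P * vecEntropy Q) ≤
        vecEntropy (addConv P Q))
    {p : PMF α} {u₁ u₂ : α → G} {s₁ : α → S} {s₂ : α → T}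
    (h : PMFIndep p (fun z => (u₁ z, s₁ z)) fun z => (u₂ z, s₂ z)) :
    c₀ + c₁ * (condEnt p u₁ s₁).toReal + c₂ * (condEnt p u₂ s₂).toReal +
        c₃ * ((condEnt p u₁ s₁).toReal * (condEnt p u₂ s₂).toReal) ≤
      (condEnt p (fun z => u₁ z + u₂ z) fun z => (s₁ z, s₂ z)).toReal := by
  set m : S → ℝ := fun a => (p.map s₁ a).toReal with hm
  set n : T → ℝ := fun b => (p.map s₂ b).toReal with hn
  set g : S → ℝ := fun a => massEntropy (fiberMass p u₁ s₁ a) with hg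
  set k : T → ℝ := fun b => massEntropy (fiberMass p u₂ s₂ b) with hk
  have Hm : HasSum m 1 := PMF.hasSum_toReal _
  have Hn : HasSum n 1 := PMF.hasSum_toReal _
  have Hg : HasSum g _ := hasSum_condEnt p u₁ s₁
  have Hk : HasSum k _ := hasSum_condEnt p u₂ s₂
  have hm0 : 0 ≤ m := fun a => ENNReal.toReal_nonneg
  have hn0 : 0 ≤ n := fun a => ENNReal.toReal_nonneg
  have hg0 : 0 ≤ g := fun a => massEntropy_nonneg (fiberMass_nonneg _ _ _ _)
  have hk0 : 0 ≤ k := fun a => massEntropy_nonneg (fiberMass_nonneg _ _ _ _)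
  -- By independence the fibre at `(a, b)` has weight `m a * n b`, so the constant, linear and
  -- product terms sum to `1`, the two entropies and their product.
  have H00 := Hm.mul Hn (Hm.summable.mul_of_nonneg Hn.summable hm0 hn0)
  have H10 := Hg.mul Hn (Hg.summable.mul_of_nonneg Hn.summable hg0 hn0)
  have H01 := Hm.mul Hk (Hm.summable.mul_of_nonneg Hk.summable hm0 hk0)
  have H11 := Hg.mul Hk (Hg.summable.mul_of_nonneg Hk.summable hg0 hk0)
  have Hl := (((H00.mul_left c₀).add (H10.mul_left c₁)).add (H01.mul_left c₂)).add
    (H11.mul_left c₃)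
  have Hr := hasSum_condEnt p (fun z => u₁ z + u₂ z) fun z => (s₁ z, s₂ z)
  have hle := hasSum_le (fun ab => ?_) Hl Hr
  · linarith
  obtain ⟨a, b⟩ := ab
  have hr0 := massEntropy_nonneg
    (fiberMass_nonneg p (fun z => u₁ z + u₂ z) (fun z => (s₁ z, s₂ z)) (a, b))
  by_cases ha : m a = 0
  · have : g a = 0 := massEntropy_fiberMass_of_eq_zero p u₁ s₁ a ha
    simpa [ha, this] using hr0
  by_cases hb : n b = 0
  · have : k b = 0 := massEntropy_fiberMass_of_eq_zero p u₂ s₂ b hb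
    simpa [hb, this] using hr0
  obtain ⟨P, hP, hPe⟩ := exists_eq_smul_of_fiberMass p u₁ s₁ a ha
  obtain ⟨Q, hQ, hQe⟩ := exists_eq_smul_of_fiberMass p u₂ s₂ b hb
  have e1 : g a = m a * vecEntropy P := by
    simp only [hg, hPe, massEntropy_smul, massEntropy_of_mem_stdSimplex hP, hm]
  have e2 : k b = n b * vecEntropy Q := by
    simp only [hk, hQe, massEntropy_smul, massEntropy_of_mem_stdSimplex hQ, hn]
  rw [fiberMass_add_of_indep h, hPe, hQe, addConv_smul_smul, massEntropy_smul,
    massEntropy_of_mem_stdSimplex (addConv_mem_stdSimplex hP hQ)]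
  have := mul_le_mul_of_nonneg_left (hc P hP Q hQ) (mul_nonneg (hm0 a) (hn0 b))
  simp only [e1, e2]
  refine le_trans (le_of_eq ?_) this
  ring

variable {q : ℕ} [Fact q.Prime] {p : PMF α} {u₁ u₂ : α → ZMod q} {s₁ : α → S} {s₂ : α → T}

/-- The pointwise gain is quadratic in the entropy `v` of the second vector. Replacing `v ^ 2` by
its tangent `2 H v - H ^ 2` at the mean makes the bound bilinear and loses nothing after averaging.
-/
theorem condEnt_add_gain (h : PMFIndep p (fun z => (u₁ z, s₁ z)) fun z => (u₂ z, s₂ z)) {H : ℝ}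
    (h₁ : (condEnt p u₁ s₁).toReal = H) (h₂ : (condEnt p u₂ s₂).toReal = H) :
    (log q - H) * H ^ 2 ≤ 16 * (q : ℝ) ^ 4 *
      ((condEnt p (fun z => u₁ z + u₂ z) fun z => (s₁ z, s₂ z)).toReal - H) := by
  have hq : 0 < (q : ℝ) := by exact_mod_cast (Fact.out : q.Prime).pos
  set κ : ℝ := (16 * (q : ℝ) ^ 4)⁻¹ with hκ
  have e : κ * (16 * (q : ℝ) ^ 4) = 1 := inv_mul_cancel₀ (by positivity)
  have hκ0 : 0 < κ := by positivity
  have := bilinear_le_condEnt_add (c₀ := -κ * log q * H ^ 2) (c₁ := 1 + κ * H ^ 2)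
    (c₂ := 2 * κ * log q * H) (c₃ := -(2 * κ * H)) (fun P hP Q hQ => ?_) h
  · rw [h₁, h₂] at this
    have h3 := mul_le_mul_of_nonneg_left this (by positivity : 0 ≤ 16 * (q : ℝ) ^ 4)
    linear_combination h3 - (log q - H) * H ^ 2 * e
  · have h1 := mul_le_mul_of_nonneg_left (vecEntropy_addConv_gain hP hQ) hκ0.le
    have h2 := vecEntropy_le_log_card hP
    rw [ZMod.card] at h2
    have h3 := mul_nonneg (mul_nonneg hκ0.le (sub_nonneg.2 h2)) (sq_nonneg (vecEntropy Q - H))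
    rw [← mul_assoc, ← mul_assoc κ, e, one_mul] at h1
    nlinarith

theorem condEnt_add_deficit (h : PMFIndep p (fun z => (u₁ z, s₁ z)) fun z => (u₂ z, s₂ z)) {H : ℝ}
    (h₁ : (condEnt p u₁ s₁).toReal = H) (h₂ : (condEnt p u₂ s₂).toReal = H) :
    log q - (condEnt p (fun z => u₁ z + u₂ z) fun z => (s₁ z, s₂ z)).toReal ≤
      4 * (q : ℝ) ^ 2 * (log q - H) ^ 2 := by
  have := bilinear_le_condEnt_add (c₀ := log q - 4 * (q : ℝ) ^ 2 * log q ^ 2)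
    (c₁ := 4 * (q : ℝ) ^ 2 * log q) (c₂ := 4 * (q : ℝ) ^ 2 * log q) (c₃ := -(4 * (q : ℝ) ^ 2))
    (fun P hP Q hQ => ?_) h
  · rw [h₁, h₂] at this
    linear_combination this
  · have h1 := entropy_deficit_addConv_le hP hQ
    rw [ZMod.card] at h1
    linear_combination h1

variable (q) in
theorem exists_le_condEnt_add {ε : ℝ} (hε : 0 < ε) (hε1 : ε < 1) :
    ∃ K : ℝ, 0 ≤ K ∧ ∀ {α S T : Type*} {p : PMF α} {u₁ u₂ : α → ZMod q} {s₁ : α → S}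
      {s₂ : α → T}, PMFIndep p (fun z => (u₁ z, s₁ z)) (fun z => (u₂ z, s₂ z)) → ∀ {H : ℝ},
      (condEnt p u₁ s₁).toReal = H → (condEnt p u₂ s₂).toReal = H →
      (1 - ε) * (2 * H) - K * H ^ 2 ≤
        (condEnt p (fun z => u₁ z + u₂ z) fun z => (s₁ z, s₂ z)).toReal := by
  obtain ⟨K, hK0, hK⟩ := exists_vecEntropy_add_le_addConv (ZMod q) hε hε1
  refine ⟨K, hK0, fun h H h₁ h₂ => ?_⟩
  have := bilinear_le_condEnt_add (c₀ := 0) (c₁ := 1 - ε) (c₂ := 1 - ε) (c₃ := -K)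
    (fun P hP Q hQ => ?_) h
  · rw [h₁, h₂] at this
    linear_combination this
  · linear_combination hK P hP Q hQ

end IndepSum

/-! ### Product laws -/

section IidLaw

variable {α : Type u} {β : Type v} {S T : Type*}

theorem iidLaw_map (p : PMF α) (f : α → β) (n : ℕ) :
    (iidLaw p n).map (fun z i => f (z i)) = iidLaw (p.map f) n := by
  induction n with
  | zero =>
    simp only [iidLaw, PMF.pure_map]
    exact congrArg _ (Subsingleton.elim _ _)
  | succ n ih =>
    simp only [iidLaw, PMF.map_bind, PMF.bind_map, PMF.map_comp, ← ih]
    congr 1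
    funext a
    simp only [Function.comp_def]
    congr 1
    funext g i
    refine Fin.cases ?_ (fun j => ?_) i <;> simp

theorem iidLaw_map_eval (p : PMF α) {n : ℕ} (i : Fin n) : (iidLaw p n).map (fun z => z i) = p := by
  induction n with
  | zero => exact i.elim0
  | succ n ih =>
    simp only [iidLaw, PMF.map_bind, PMF.map_comp]
    refine Fin.cases ?_ (fun j => ?_) i
    · have : ∀ a : α, (iidLaw p n).map ((fun z : Fin (n + 1) → α => z 0) ∘ fun g => Fin.cons a g) =
          PMF.pure a := fun a => PMF.map_const (iidLaw p n) a
      simp [this]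
    · have : ∀ a : α, (iidLaw p n).map
          ((fun z : Fin (n + 1) → α => z j.succ) ∘ fun g => Fin.cons a g) = p :=
        fun a => ih j
      simp [this]

/-- The factors need not be normalized: their total masses multiply to `1`, which is exactly the
correction between them and the marginals. -/
theorem PMFIndep.of_apply_eq_mul {p : PMF β} {f : β → S} {g : β → T}
    (hfg : Function.Bijective fun z => (f z, g z)) {A : S → ℝ≥0∞} {B : T → ℝ≥0∞}
    (h : ∀ z, p z = A (f z) * B (g z)) : PMFIndep p f g := by
  classical
  set e := Equiv.ofBijective _ hfg
  have hpair : ∀ b c, p.map (fun z => (f z, g z)) (b, c) = A b * B c := by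
    intro b c
    obtain ⟨z, hz⟩ := hfg.2 (b, c)
    have h1 := PMF.map_apply_of_injective p hfg.1 z
    rw [Prod.mk.injEq] at hz
    rw [← hz.1, ← hz.2, h1, h]
  have hf : ∀ b, p.map f b = A b * ∑' c, B c := by
    intro b
    have : p.map f = (p.map fun z => (f z, g z)).map Prod.fst := by rw [PMF.map_comp]; rfl
    rw [this, PMF.map_apply, ENNReal.tsum_prod', tsum_eq_single b fun b' hb => by simp [hb.symm]]
    simp [hpair, ENNReal.tsum_mul_left]
  have hg : ∀ c, p.map g c = (∑' b, A b) * B c := by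
    intro c
    have : p.map g = (p.map fun z => (f z, g z)).map Prod.snd := by rw [PMF.map_comp]; rfl
    rw [this, PMF.map_apply, ENNReal.tsum_prod', ENNReal.tsum_comm,
      tsum_eq_single c fun b' hb => by simp [hb.symm]]
    simp [hpair, ENNReal.tsum_mul_right]
  have hone : (∑' b, A b) * ∑' c, B c = 1 := by
    rw [← PMF.tsum_coe (p.map f)]
    simp only [hf, ENNReal.tsum_mul_right]
  refine PMF.ext fun ⟨b, c⟩ => ?_
  rw [PMF.bind_map_prodMk_apply, hpair, hf, hg]
  calc A b * B c = A b * B c * ((∑' b, A b) * ∑' c, B c) := by rw [hone, mul_one]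
    _ = _ := by ring

theorem iidLaw_indep (p : PMF α) {n : ℕ} (I : Fin n → Prop) :
    PMFIndep (iidLaw p n) (fun z (i : {i // I i}) => z i) fun z (i : {i // ¬ I i}) => z i := by
  classical
  refine PMFIndep.of_apply_eq_mul (Equiv.piEquivPiSubtypeProd I fun _ => α).bijective
    (A := fun y => ∏ i, p (y i)) (B := fun y => ∏ i, p (y i)) fun z => ?_
  rw [iidLaw_apply, ← Fintype.prod_subtype_mul_prod_subtype I]

theorem iidLaw_indep_pair (p : PMF α) {n : ℕ} {i j : Fin n} (hij : i ≠ j) :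
    PMFIndep (iidLaw p n) (fun z => z i) fun z => z j :=
  (iidLaw_indep p fun l => l = i).comp (fun y => y ⟨i, rfl⟩) fun y => y ⟨j, hij.symm⟩

end IidLaw

/-! ### Polarization by mixing matrices -/

section Mixing

variable {q k : ℕ} {M : Matrix (Fin k) (Fin k) (ZMod q)}

theorem exists_first_ne_zero {α : Type*} [Zero α] {n : ℕ} {f : Fin n → α} (hf : f ≠ 0) :
    ∃ l, f l ≠ 0 ∧ ∀ j < l, f j = 0 := by
  obtain ⟨i, hi⟩ := Function.ne_iff.1 hf
  obtain ⟨l, hl, hmin⟩ := WellFounded.has_min (wellFounded_lt (α := Fin n)) {j | f j ≠ 0} ⟨i, hi⟩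
  exact ⟨l, hl, fun j hj => by_contra fun h => hmin j h hj⟩

theorem exists_last_ne_zero {α : Type*} [Zero α] {n : ℕ} {f : Fin n → α} (hf : f ≠ 0) :
    ∃ l, f l ≠ 0 ∧ ∀ j, l < j → f j = 0 := by
  obtain ⟨i, hi⟩ := Function.ne_iff.1 hf
  obtain ⟨l, hl, hmin⟩ := WellFounded.has_min (wellFounded_gt (α := Fin n)) {j | f j ≠ 0} ⟨i, hi⟩
  exact ⟨l, hl, fun j hj => by_contra fun h => hmin j h hj⟩

/-- A mixing matrix has two rows with the same leading position. -/
theorem IsMixing.exists_rows [Fact q.Prime] (h : IsMixing M) :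
    ∃ l i i', i ≠ i' ∧ M i l ≠ 0 ∧ M i' l ≠ 0 ∧ ∀ j < l, M i j = 0 ∧ M i' j = 0 := by
  have hrow : ∀ i, ∃ l, M i l ≠ 0 ∧ ∀ j < l, M i j = 0 := fun i => by
    refine exists_first_ne_zero fun h0 => ?_
    have hdet := (Matrix.isUnit_iff_isUnit_det M).1 h.1
    rw [Matrix.det_eq_zero_of_row_eq_zero i fun j => congrFun h0 j] at hdet
    exact not_isUnit_zero hdet
  choose lead hlead hzero using hrow
  by_cases hinj : Function.Injective lead
  · refine absurd ?_ (h.2 (Equiv.ofBijective lead (Finite.injective_iff_bijective.1 hinj)).symm)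
    intro r j hj
    refine hzero _ j ?_
    have : lead ((Equiv.ofBijective lead (Finite.injective_iff_bijective.1 hinj)).symm r) = r :=
      Equiv.ofBijective_apply_symm_apply lead _ r
    rw [this]
    exact hj
  · rw [Function.not_injective_iff] at hinj
    obtain ⟨i, i', he, hne⟩ := hinj
    exact ⟨lead i, i, i', hne, hlead i, he ▸ hlead i', fun j hj =>
      ⟨hzero i j hj, hzero i' j (he ▸ hj)⟩⟩

/-- The inverse of a mixing matrix has two columns with the same last nonzero position. -/
theorem IsMixing.exists_cols_inv [Fact q.Prime] (h : IsMixing M) :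
    ∃ l i i', i ≠ i' ∧ M⁻¹ l i ≠ 0 ∧ M⁻¹ l i' ≠ 0 ∧
      ∀ j, l < j → M⁻¹ j i = 0 ∧ M⁻¹ j i' = 0 := by
  have hM := (Matrix.isUnit_iff_isUnit_det M).1 h.1
  have hN := Matrix.isUnit_nonsing_inv_det M hM
  have hcol : ∀ i, ∃ l, M⁻¹ l i ≠ 0 ∧ ∀ j, l < j → M⁻¹ j i = 0 := fun i => by
    refine exists_last_ne_zero (f := fun j => M⁻¹ j i) fun h0 => ?_
    rw [Matrix.det_eq_zero_of_column_eq_zero i fun j => congrFun h0 j] at hN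
    exact not_isUnit_zero hN
  choose low hlow hzero using hcol
  by_cases hinj : Function.Injective low
  -- Otherwise sorting the columns of `M⁻¹` by last nonzero position makes it upper triangular; the
  -- inverse of that matrix is a row permutation of `M` and is again upper triangular.
  · set σ := (Equiv.ofBijective low (Finite.injective_iff_bijective.1 hinj)).symm with hσ
    refine absurd ?_ (h.2 σ)
    have hU : (M⁻¹.submatrix (Equiv.refl _) σ).IsUpperTriangular := by
      intro j r hj
      refine hzero _ j ?_
      have : low (σ r) = r := Equiv.ofBijective_apply_symm_apply low _ r
      rw [this]
      exact hj
    have hinv : M.submatrix σ id = (M⁻¹.submatrix (Equiv.refl _) σ)⁻¹ := by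
      rw [Matrix.inv_submatrix_equiv, Matrix.nonsing_inv_nonsing_inv M hM]
      rfl
    rw [hinv]
    have : Invertible (M⁻¹.submatrix (Equiv.refl _) σ) := by
      refine ((Matrix.isUnit_iff_isUnit_det _).2 ?_).invertible
      have := (Matrix.isUnit_submatrix_equiv (A := M⁻¹) (Equiv.refl (Fin k)) σ).2
        ((Matrix.isUnit_iff_isUnit_det _).2 hN)
      exact (Matrix.isUnit_iff_isUnit_det _).1 this
    exact Matrix.blockTriangular_inv_of_blockTriangular hU
  · rw [Function.not_injective_iff] at hinj
    obtain ⟨i, i', he, hne⟩ := hinj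
    exact ⟨low i, i, i', hne, hlow i, he ▸ hlow i', fun j hj =>
      ⟨hzero i j hj, hzero i' j (he ▸ hj)⟩⟩

end Mixing

/-! ### Entropies after one application of the matrix -/

section MatrixStep

open Real

variable {q k : ℕ} [Fact q.Prime] {S : Type u} (M : Matrix (Fin k) (Fin k) (ZMod q))
  (p : PMF (ZMod q × S))

/-- The entropy, in nats, of the `l`-th output of the matrix given the previous outputs and the
side information. -/
noncomputable def stepEnt (l : Fin k) : ℝ≥0∞ :=
  condEnt (iidLaw p k) (fun z => (matrixStep M l z).1) fun z => (matrixStep M l z).2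

theorem stepEnt_ne_top (l : Fin k) : stepEnt M p l ≠ ⊤ := condEnt_ne_top _ _ _

theorem condEntropy_map_matrixStep (l : Fin k) :
    condEntropy ((iidLaw p k).map (matrixStep M l)) = (stepEnt M p l).toReal / log q :=
  condEntropy_map (iidLaw p k) (fun z => (matrixStep M l z).1) fun z => (matrixStep M l z).2

theorem condEnt_iidLaw_eval (i : Fin k) :
    condEnt (iidLaw p k) (fun z => (z i).1) (fun z => (z i).2) = condEnt p Prod.fst Prod.snd := by
  rw [← condEnt_map (iidLaw p k) (fun z => z i) Prod.fst Prod.snd, iidLaw_map_eval]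

theorem condEnt_iidLaw_mul_eval {a : ZMod q} (ha : a ≠ 0) (i : Fin k) :
    condEnt (iidLaw p k) (fun z => a * (z i).1) (fun z => (z i).2) =
      condEnt p Prod.fst Prod.snd := by
  rw [← condEnt_iidLaw_eval p i]
  exact condEnt_congr _ (fun _ _ => Iff.rfl) fun z z' _ => mul_right_inj' ha

theorem iidLaw_indep_mul {i i' : Fin k} (hne : i ≠ i') (a b : ZMod q) :
    PMFIndep (iidLaw p k) (fun z => (a * (z i).1, (z i).2)) fun z => (b * (z i').1, (z i').2) :=
  (iidLaw_indep_pair p hne).comp (fun y => (a * y.1, y.2)) fun y => (b * y.1, y.2)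

variable {M}

/-- By the chain rule the sum is the joint entropy of `U M`, which is that of `U` by invertibility;
independence then splits it into `k` equal terms. -/
theorem sum_stepEnt (hM : IsUnit M) :
    ∑ l, stepEnt M p l = k * condEnt p Prod.fst Prod.snd := by
  have hinj : Function.Injective fun v : Fin k → ZMod q => Matrix.vecMul v M :=
    Matrix.vecMul_injective_of_isUnit hM
  have h1 : ∑ l, stepEnt M p l = condEnt (iidLaw p k)
      (fun z => Matrix.vecMul (fun i => (z i).1) M) fun z i => (z i).2 :=
    (condEnt_pi_eq_sum (iidLaw p k) (fun z i => (z i).2)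
      fun z => Matrix.vecMul (fun i => (z i).1) M).symm
  have h3 : condEnt (iidLaw p k) (fun z => Matrix.vecMul (fun i => (z i).1) M)
      (fun z i => (z i).2) = condEnt (iidLaw p k) (fun z i => (z i).1) fun z i => (z i).2 :=
    condEnt_congr _ (fun _ _ => Iff.rfl) fun z z' _ => hinj.eq_iff
  rw [h1, h3, condEnt_pi_eq_sum]
  have h2 : ∀ l : Fin k, (condEnt (iidLaw p k) (fun z => (z l).1)
      fun z => ((fun i : {i : Fin k // i < l} => (z i).1), fun i => (z i).2)) =
        condEnt p Prod.fst Prod.snd := by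
    intro l
    rw [← condEnt_iidLaw_eval p l]
    refine le_antisymm (condEnt_le_of_factors _ (fun z z' h => ?_) fun z z' _ h => h) ?_
    · rw [Prod.mk.injEq] at h
      exact congrFun h.2 l
    · rw [← condEnt_prodMk_of_indep ((iidLaw_indep p fun i => i = l).comp
        (fun y => ((y ⟨l, rfl⟩).1, (y ⟨l, rfl⟩).2)) id)]
      refine condEnt_le_of_factors _ (fun z z' h => ?_) fun z z' _ h => h
      simp only [Prod.mk.injEq, id, funext_iff, Subtype.forall] at h ⊢
      refine ⟨fun i hi => by rw [h.2 i hi.ne], fun i => ?_⟩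
      by_cases hi : i = l
      · rw [hi, h.1]
      · rw [h.2 i hi]
  simp [h2]

/-- At the common leading column of two rows, the earlier outputs do not involve `U_i` or `U_{i'}`.
Revealing all other pairs can only lower the entropy, and leaves just `a U_i + b U_{i'}` unknown. -/
theorem exists_le_stepEnt (hM : IsMixing M) :
    ∃ l i i' : Fin k, ∃ a b : ZMod q, i ≠ i' ∧ a ≠ 0 ∧ b ≠ 0 ∧
      ∀ {S : Type u} (p : PMF (ZMod q × S)),
      condEnt (iidLaw p k) (fun z => a * (z i).1 + b * (z i').1) (fun z => ((z i).2, (z i').2)) ≤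
        stepEnt M p l := by
  obtain ⟨l, i, i', hne, ha, hb, hz⟩ := hM.exists_rows
  refine ⟨l, i, i', M i l, M i' l, hne, ha, hb, fun p => ?_⟩
  rw [← condEnt_prodMk_of_indep ((iidLaw_indep p fun m => m = i ∨ m = i').comp
    (fun y => (M i l * (y ⟨i, Or.inl rfl⟩).1 + M i' l * (y ⟨i', Or.inr rfl⟩).1,
      ((y ⟨i, Or.inl rfl⟩).2, (y ⟨i', Or.inr rfl⟩).2))) id)]
  refine condEnt_le_of_factors _ (fun z z' h => ?_) fun z z' h h' => ?_
  · simp only [Prod.mk.injEq, id, funext_iff, Subtype.forall, not_or] at h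
    simp only [matrixStep, Prod.mk.injEq, funext_iff, Subtype.forall]
    refine ⟨fun j hj => ?_, fun m => ?_⟩
    · simp only [Matrix.vecMul, dotProduct]
      refine Finset.sum_congr rfl fun m _ => ?_
      by_cases hm : m = i
      · rw [hm, (hz j hj).1, mul_zero, mul_zero]
      by_cases hm' : m = i'
      · rw [hm', (hz j hj).2, mul_zero, mul_zero]
      rw [h.2 m ⟨hm, hm'⟩]
    · by_cases hm : m = i
      · rw [hm, h.1.1]
      by_cases hm' : m = i'
      · rw [hm', h.1.2]
      rw [h.2 m ⟨hm, hm'⟩]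
  · simp only [Prod.mk.injEq, id, funext_iff, Subtype.forall, not_or] at h
    have h0 : ∑ m, ((z m).1 - (z' m).1) * M m l = 0 := by
      simp only [sub_mul, Finset.sum_sub_distrib]
      exact sub_eq_zero.2 h'
    rw [Fintype.sum_eq_add i i' hne fun m hm => by rw [h.2 m hm, sub_self, zero_mul]] at h0
    linear_combination h0

/-- Write `V = U M`. In terms of `V`, both `U_i` and `U_{i'}` involve only coordinates up to `l`,
and `a, b` are chosen so that `V_l` cancels in `T = a U_i + b U_{i'}`. Thus `V_{<l}` determines `T`,
and given `V_{<l}` the variables `V_l` and `U_i` determine each other. So the step entropy is at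
most that of `U_i` given `T` and the side information, which the chain rule evaluates as `2 H` minus
the entropy of `T`. -/
theorem exists_stepEnt_le (hM : IsMixing M) :
    ∃ l i i' : Fin k, ∃ a b : ZMod q, i ≠ i' ∧ a ≠ 0 ∧ b ≠ 0 ∧
      ∀ {S : Type u} (p : PMF (ZMod q × S)),
      condEnt (iidLaw p k) (fun z => a * (z i).1 + b * (z i').1) (fun z => ((z i).2, (z i').2)) +
        stepEnt M p l ≤ 2 * condEnt p Prod.fst Prod.snd := by
  obtain ⟨l, i, i', hne, hi, hi', hz⟩ := hM.exists_cols_inv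
  have hdet := (Matrix.isUnit_iff_isUnit_det M).1 hM.1
  refine ⟨l, i, i', M⁻¹ l i', -M⁻¹ l i, hne, hi', neg_ne_zero.2 hi, fun {S} p => ?_⟩
  set T : (Fin k → ZMod q × S) → ZMod q :=
    fun z => M⁻¹ l i' * (z i).1 + -M⁻¹ l i * (z i').1 with hT
  set A : (Fin k → ZMod q × S) → S × S := fun z => ((z i).2, (z i').2) with hA
  have hrec : ∀ z : Fin k → ZMod q × S, ∀ m,
      (z m).1 = ∑ j, Matrix.vecMul (fun i => (z i).1) M j * M⁻¹ j m := by
    intro z m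
    have : Matrix.vecMul (Matrix.vecMul (fun i => (z i).1) M) M⁻¹ = fun i => (z i).1 := by
      rw [Matrix.vecMul_vecMul, Matrix.mul_nonsing_inv M hdet, Matrix.vecMul_one]
    exact (congrFun this m).symm
  have h1 : stepEnt M p l ≤ condEnt (iidLaw p k) (fun z => (z i).1) fun z => (T z, A z) := by
    refine condEnt_le_of_factors _ (fun z z' h => ?_) fun z z' h h' => ?_
    · simp only [matrixStep, Prod.mk.injEq, funext_iff, Subtype.forall] at h
      simp only [Prod.mk.injEq, hT, hA, h.2, and_true]
      rw [hrec z i, hrec z i', hrec z' i, hrec z' i', Finset.mul_sum, Finset.mul_sum,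
        Finset.mul_sum, Finset.mul_sum, ← Finset.sum_add_distrib, ← Finset.sum_add_distrib]
      refine Finset.sum_congr rfl fun j _ => ?_
      rcases lt_trichotomy j l with hj | hj | hj
      · rw [h.1 j hj]
      · rw [hj]; ring
      · rw [(hz j hj).1, (hz j hj).2]; ring
    · simp only [matrixStep, Prod.mk.injEq, funext_iff, Subtype.forall] at h
      have h0 : ∑ j, (Matrix.vecMul (fun i => (z i).1) M j -
          Matrix.vecMul (fun i => (z' i).1) M j) * M⁻¹ j i = 0 := by
        simp only [sub_mul, Finset.sum_sub_distrib]
        rw [← hrec, ← hrec]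
        exact sub_eq_zero.2 h'
      rw [Fintype.sum_eq_single l fun j hj => ?_] at h0
      · exact sub_eq_zero.1 ((mul_eq_zero.1 h0).resolve_right hi)
      · rcases lt_or_gt_of_ne hj with hj | hj
        · rw [h.1 j hj, sub_self, zero_mul]
        · rw [(hz j hj).1, mul_zero]
  have h2 : condEnt (iidLaw p k) (fun z => ((z i).1, T z)) A =
      condEnt (iidLaw p k) (fun z => ((z i).1, (z i').1)) A := by
    refine condEnt_congr _ (fun _ _ => Iff.rfl) fun z z' _ => ?_
    simp only [Prod.mk.injEq]
    refine and_congr_right fun h => ?_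
    simp only [hT, h, add_right_inj]
    exact mul_right_inj' (neg_ne_zero.2 hi)
  have h3 : condEnt (iidLaw p k) (fun z => (z i').1) A = condEnt p Prod.fst Prod.snd := by
    rw [← condEnt_iidLaw_eval p i', ← condEnt_prodMk_of_indep
      ((iidLaw_indep_pair p hne.symm).comp (fun y => (y.1, y.2)) Prod.snd)]
    exact condEnt_congr _ (fun z z' => by simp only [hA, Prod.mk.injEq, and_comm])
      fun _ _ _ => Iff.rfl
  have h4 : (condEnt (iidLaw p k) (fun z => (z i).1) fun z => ((z i').1, A z)) =
      condEnt p Prod.fst Prod.snd := by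
    rw [← condEnt_iidLaw_eval p i, ← condEnt_prodMk_of_indep
      ((iidLaw_indep_pair p hne).comp (fun y => (y.1, y.2)) fun y => (y.1, y.2))]
    exact condEnt_congr _ (fun z z' => by simp only [hA, Prod.mk.injEq]; tauto)
      fun _ _ _ => Iff.rfl
  calc condEnt (iidLaw p k) T A + stepEnt M p l
      ≤ condEnt (iidLaw p k) T A + condEnt (iidLaw p k) (fun z => (z i).1) fun z => (T z, A z) := by
        gcongr
    _ = 2 * condEnt p Prod.fst Prod.snd := by
        rw [← condEnt_prodMk, h2, condEnt_prodMk, h3, h4, two_mul]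

theorem log_prime_pos (q : ℕ) [Fact q.Prime] : 0 < log q :=
  log_pos (by exact_mod_cast (Fact.out : q.Prime).one_lt)

theorem sum_condEntropy_matrixStep (hM : IsUnit M) :
    ∑ l, condEntropy ((iidLaw p k).map (matrixStep M l)) = k * condEntropy p := by
  simp only [condEntropy_map_matrixStep]
  rw [← Finset.sum_div, ← ENNReal.toReal_sum fun l _ => stepEnt_ne_top M p l, sum_stepEnt p hM,
    condEntropy_eq, ENNReal.toReal_mul, ENNReal.toReal_natCast, mul_div_assoc]

theorem matrixStep_variance (hM : IsMixing M) {τ : ℝ} (hτ : 0 < τ) :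
    ∃ ε : ℝ, 0 < ε ∧ ∀ (S : Type u) (p : PMF (ZMod q × S)), condEntropy p ∈ Set.Ioo τ (1 - τ) →
      ∃ l, condEntropy p + ε ≤ condEntropy ((iidLaw p k).map (matrixStep M l)) := by
  obtain ⟨l, i, i', a, b, hne, ha, hb, hle⟩ := exists_le_stepEnt.{u} hM
  have hL := log_prime_pos q
  have hq : 0 < (q : ℝ) := by exact_mod_cast (Fact.out : q.Prime).pos
  refine ⟨log q ^ 2 * τ ^ 3 / (16 * (q : ℝ) ^ 4), by positivity, fun S p hp => ⟨l, ?_⟩⟩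
  set H := (condEnt p Prod.fst Prod.snd).toReal with hH
  have h1 := condEnt_add_gain (iidLaw_indep_mul p hne a b) (H := H)
    (by rw [condEnt_iidLaw_mul_eval p ha]) (by rw [condEnt_iidLaw_mul_eval p hb])
  have h2 := ENNReal.toReal_mono (stepEnt_ne_top M p l) (hle p)
  set K := (condEnt (iidLaw p k) (fun z => a * (z i).1 + b * (z i').1)
    fun z => ((z i).2, (z i').2)).toReal with hK
  have hh : condEntropy p = H / log q := condEntropy_eq p
  rw [condEntropy_map_matrixStep, hh]
  rw [hh] at hp
  have e : H = log q * (H / log q) := by field_simp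
  set h := H / log q with hh'
  have h3 : (h + log q ^ 2 * τ ^ 3 / (16 * (q : ℝ) ^ 4)) * log q ≤ K := by
    have h4 : log q * (log q ^ 2 * τ ^ 3) ≤ (log q - H) * H ^ 2 := by
      rw [e]
      have h5 : τ ^ 2 ≤ h ^ 2 := pow_le_pow_left₀ hτ.le hp.1.le 2
      have h6 : τ * τ ^ 2 ≤ (1 - h) * h ^ 2 :=
        mul_le_mul (by linarith [hp.2]) h5 (sq_nonneg _) (by linarith [hp.2])
      have := mul_le_mul_of_nonneg_left h6 (pow_nonneg hL.le 3)
      linarith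
    have h7 : log q ^ 2 * τ ^ 3 / (16 * (q : ℝ) ^ 4) * log q ≤ K - H := by
      rw [div_mul_eq_mul_div, div_le_iff₀ (by positivity)]
      linarith
    rw [add_mul]
    linarith
  rw [le_div_iff₀ hL]
  exact h3.trans h2

theorem matrixStep_suction_low (hM : IsMixing M) {c : ℝ} (hc : 0 < c) :
    ∃ τ : ℝ, 0 < τ ∧ ∀ (S : Type u) (p : PMF (ZMod q × S)), condEntropy p ≤ τ →
      ∃ l, condEntropy ((iidLaw p k).map (matrixStep M l)) ≤ condEntropy p / c := by
  obtain ⟨l, i, i', a, b, hne, ha, hb, hle⟩ := exists_stepEnt_le.{u} hM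
  have hL := log_prime_pos q
  -- The output entropy is at most `2 ε H + C H ^ 2`; the choices of `ε` and of the threshold make
  -- each term at most `H / (2 c)`.
  have hε0 : 0 < min (1 / 2) (1 / (4 * c)) := by positivity
  have hε1 : min (1 / 2) (1 / (4 * c)) < 1 := (min_le_left _ _).trans_lt (by norm_num)
  have hε2 := min_le_right (1 / 2) (1 / (4 * c))
  set ε := min (1 / 2) (1 / (4 * c))
  obtain ⟨C, hC0, hC⟩ := exists_le_condEnt_add.{u, u, u} q hε0 hε1
  refine ⟨1 / (2 * c * (log q * C + 1)), by positivity, fun S p hp => ⟨l, ?_⟩⟩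
  set H := (condEnt p Prod.fst Prod.snd).toReal with hH
  have h1 := hC (iidLaw_indep_mul p hne a b) (H := H)
    (by rw [condEnt_iidLaw_mul_eval p ha]) (by rw [condEnt_iidLaw_mul_eval p hb])
  have h2 := ENNReal.toReal_mono (ENNReal.mul_ne_top ENNReal.ofNat_ne_top (condEnt_ne_top _ _ _))
    (hle p)
  rw [ENNReal.toReal_add (condEnt_ne_top _ _ _) (stepEnt_ne_top M p l), ENNReal.toReal_mul,
    ENNReal.toReal_ofNat, ← hH] at h2
  have hh : condEntropy p = H / log q := condEntropy_eq p
  have hH0 : 0 ≤ H := ENNReal.toReal_nonneg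
  rw [condEntropy_map_matrixStep, hh, div_right_comm]
  rw [hh, div_le_iff₀ hL, div_mul_eq_mul_div, one_mul, le_div_iff₀ (by positivity)] at hp
  gcongr
  rw [le_div_iff₀ hc]
  rw [le_div_iff₀ (by positivity)] at hε2
  have h3 : 2 * c * (C * H) ≤ 1 := by
    have : H * (2 * c * (log q * C)) ≤ log q := by nlinarith
    have h4 : log q * (2 * c * (C * H)) ≤ log q * 1 := by linarith
    exact le_of_mul_le_mul_left h4 hL
  have h5 : (stepEnt M p l).toReal ≤ 2 * ε * H + C * H ^ 2 := by linarith
  have h6 := mul_le_mul_of_nonneg_right h5 hc.le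
  have h7 := mul_le_mul_of_nonneg_right h3 hH0
  have h8 := mul_le_mul_of_nonneg_right hε2 hH0
  linarith

theorem matrixStep_suction_high (hM : IsMixing M) {c : ℝ} (hc : 0 < c) :
    ∃ τ : ℝ, 0 < τ ∧ ∀ (S : Type u) (p : PMF (ZMod q × S)), 1 - condEntropy p ≤ τ →
      ∃ l, 1 - condEntropy ((iidLaw p k).map (matrixStep M l)) ≤ (1 - condEntropy p) / c := by
  obtain ⟨l, i, i', a, b, hne, ha, hb, hle⟩ := exists_le_stepEnt.{u} hM
  have hL := log_prime_pos q
  have hq : 0 < (q : ℝ) := by exact_mod_cast (Fact.out : q.Prime).pos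
  -- The normalized deficit `d` becomes at most `4 q ^ 2 (log q) d ^ 2`, and this threshold makes
  -- that at most `d / c`.
  refine ⟨1 / (4 * (q : ℝ) ^ 2 * log q * c), by positivity, fun S p hp => ⟨l, ?_⟩⟩
  set H := (condEnt p Prod.fst Prod.snd).toReal with hH
  have h1 := condEnt_add_deficit (iidLaw_indep_mul p hne a b) (H := H)
    (by rw [condEnt_iidLaw_mul_eval p ha]) (by rw [condEnt_iidLaw_mul_eval p hb])
  have h2 := ENNReal.toReal_mono (stepEnt_ne_top M p l) (hle p)
  have hh : condEntropy p = H / log q := condEntropy_eq p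
  have hh1 := (condEntropy_mem_Icc p).2
  rw [condEntropy_map_matrixStep]
  have e : H = log q * condEntropy p := by rw [hh]; field_simp
  set h := condEntropy p
  rw [le_div_iff₀ (by positivity)] at hp
  have h3 : log q - (stepEnt M p l).toReal ≤ 4 * (q : ℝ) ^ 2 * (log q * (1 - h)) ^ 2 := by
    rw [e] at h1
    linarith
  have e2 : 1 - (stepEnt M p l).toReal / log q =
      (log q - (stepEnt M p l).toReal) / log q := by field_simp
  rw [e2, div_le_div_iff₀ hL hc]
  have h4 := mul_le_mul_of_nonneg_right h3 hc.le
  have h5 := mul_le_mul_of_nonneg_left hp (mul_nonneg hL.le (sub_nonneg.2 hh1))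
  linarith

end MatrixStep

/-! ### The recursion for the entropies of the Arıkan process -/

section Recursion

theorem toLex_lt_iff_init {t k : ℕ} (x y : Fin (t + 1) → Fin k) :
    toLex x < toLex y ↔ toLex (Fin.init x) < toLex (Fin.init y) ∨
      Fin.init x = Fin.init y ∧ x (Fin.last t) < y (Fin.last t) := by
  constructor
  · rintro ⟨i, hi, hlt⟩
    refine Fin.lastCases (motive := fun i => (∀ j < i, x j = y j) → x i < y i → _) ?_ ?_ i hi hlt
    · exact fun h1 h2 => Or.inr ⟨funext fun j => h1 j.castSucc (Fin.castSucc_lt_last j), h2⟩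
    · exact fun j h1 h2 => Or.inl
        ⟨j, fun m hm => h1 m.castSucc (Fin.castSucc_lt_castSucc_iff.2 hm), h2⟩
  · rintro (⟨i, hi, hlt⟩ | ⟨h1, h2⟩)
    · refine ⟨i.castSucc, fun j hj => ?_, hlt⟩
      have hj' : (j : ℕ) < t := (Fin.lt_def.1 hj).trans i.2
      exact hi ⟨j, hj'⟩ hj
    · refine ⟨Fin.last t, fun j hj => ?_, h2⟩
      exact congrFun h1 ⟨j, hj⟩

variable {q k : ℕ} [Fact q.Prime] {Y : Type u} {M : Matrix (Fin k) (Fin k) (ZMod q)}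

/-- One step of the Arıkan process is one application of the matrix to independent copies. -/
theorem arikanEntropy_succ (hM : IsUnit M) (C : ZMod q → PMF Y) {t : ℕ}
    (j : Fin (t + 1) → Fin k) :
    arikanEntropy M C j = condEntropy ((iidLaw ((arikanLaw M C t).map (splitAt (Fin.init j))) k).map
      (matrixStep M (j (Fin.last t)))) := by
  have hinj : Function.Injective fun v : Fin k → ZMod q => Matrix.vecMul v M :=
    Matrix.vecMul_injective_of_isUnit hM
  set D := iidLaw (arikanLaw M C t) k with hD
  have h1 : arikanEntropy M C j = condEntropy (D.map fun z =>
      ((splitAt j (arikanCombine M t z)).1, (splitAt j (arikanCombine M t z)).2)) := by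
    unfold arikanEntropy
    rw [arikanLaw, PMF.map_comp]
    rfl
  have h2 : (iidLaw ((arikanLaw M C t).map (splitAt (Fin.init j))) k).map
      (matrixStep M (j (Fin.last t))) = D.map fun z =>
        ((matrixStep M (j (Fin.last t)) fun m => splitAt (Fin.init j) (z m)).1,
          (matrixStep M (j (Fin.last t)) fun m => splitAt (Fin.init j) (z m)).2) := by
    rw [← iidLaw_map, PMF.map_comp]
    rfl
  rw [h1, h2, condEntropy_map, condEntropy_map]
  congr 2
  refine condEnt_congr D (fun z z' => ?_) fun z z' _ => Iff.rfl
  simp only [splitAt, arikanCombine, matrixStep, Prod.mk.injEq, funext_iff, Subtype.forall,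
    toLex_lt_iff_init]
  constructor
  · rintro ⟨hA, hB⟩
    refine ⟨fun i hi => ?_, fun m => ⟨fun i hi => ?_, fun y => ?_⟩⟩
    · simpa using hA (Fin.snoc (Fin.init j) i) (Or.inr (by simpa using hi))
    -- An earlier block has all its `k` outputs in the conditioning, so invertibility of `M`
    -- recovers its inputs.
    · have hv : (fun s => (z s).1 i) = fun s => (z' s).1 i := by
        refine hinj (funext fun c => ?_)
        simpa using hA (Fin.snoc i c) (Or.inl (by simpa using hi))
      exact congrFun hv m
    · simpa using hB (Fin.cons m y)
  · rintro ⟨hA, hB⟩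
    refine ⟨fun i hi => ?_, fun y => (hB (y 0)).2 (Fin.tail y)⟩
    rcases hi with hi | ⟨hi, hl⟩
    · exact congrArg (fun v => Matrix.vecMul v M (i (Fin.last t)))
        (funext fun s => (hB s).1 _ hi)
    · have hi' : Fin.init i = Fin.init j := funext hi
      rw [hi']
      exact hA _ hl

theorem arikanEntropy_snoc (hM : IsUnit M) (C : ZMod q → PMF Y) {t : ℕ} (j : Fin t → Fin k)
    (l : Fin k) :
    arikanEntropy M C (Fin.snoc j l : Fin (t + 1) → Fin k) =
      condEntropy ((iidLaw ((arikanLaw M C t).map (splitAt j)) k).map (matrixStep M l)) := by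
  rw [arikanEntropy_succ hM, Fin.init_snoc, Fin.snoc_last]

end Recursion

/-! ### Processes driven by independent uniform digits -/

section DigitProcess

/-- The first `t` digits. -/
def digitHistory {Ω : Type v} {k : ℕ} (i : ℕ → Ω → Fin k) (t : ℕ) (ω : Ω) : Fin t → Fin k :=
  fun s => i s ω

theorem digitHistory_succ {Ω : Type v} {k : ℕ} (i : ℕ → Ω → Fin k) (t : ℕ) (ω : Ω) :
    digitHistory i (t + 1) ω = Fin.snoc (digitHistory i t ω) (i t ω) := by
  funext s
  refine Fin.lastCases ?_ (fun s => ?_) s <;> simp [digitHistory]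

/-- The σ-algebra generated by the first `t` digits. -/
abbrev digitSigma {Ω : Type v} {k : ℕ} (i : ℕ → Ω → Fin k) (t : ℕ) : MeasurableSpace Ω :=
  MeasurableSpace.comap (digitHistory i t) inferInstance

variable {Ω : Type v} {m : MeasurableSpace Ω} [MeasurableSpace Ω] {P : Measure Ω} {k : ℕ}
  {i : ℕ → Ω → Fin k}

theorem measurable_digitHistory (hmeas : ∀ t, Measurable (i t)) (t : ℕ) :
    Measurable (digitHistory i t) :=
  measurable_pi_lambda _ fun s => hmeas s

theorem indepFun_digitHistory (hmeas : ∀ t, Measurable (i t)) (hindep : iIndepFun i P) (t : ℕ) :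
    IndepFun (i t) (digitHistory i t) P := by
  have h := hindep.indepFun_finset {t} (Finset.range t) (by simp) hmeas
  exact h.comp
    (φ := fun y : ({t} : Finset ℕ) → Fin k => y ⟨t, Finset.mem_singleton_self t⟩)
    (ψ := fun (y : Finset.range t → Fin k) (s : Fin t) => y ⟨s, Finset.mem_range.2 s.2⟩)
    (by fun_prop) (by fun_prop)

variable [IsProbabilityMeasure P]

theorem integrable_digit_function (hmeas : ∀ t, Measurable (i t)) {t : ℕ}
    (g : (Fin t → Fin k) → Fin k → ℝ) :
    Integrable (fun ω => g (digitHistory i t ω) (i t ω)) P := by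
  obtain ⟨c, hc⟩ := (Set.finite_range fun y : (Fin t → Fin k) × Fin k => ‖g y.1 y.2‖).bddAbove
  refine Integrable.of_bound (C := c) ?_ (ae_of_all _ fun ω =>
    hc ⟨(digitHistory i t ω, i t ω), rfl⟩)
  exact ((measurable_of_countable fun y : (Fin t → Fin k) × Fin k => g y.1 y.2).comp
    ((measurable_digitHistory hmeas t).prodMk (hmeas t))).aestronglyMeasurable

/-- Split over the value `l` of the next digit: each indicator has conditional expectation `1 / k`
given the past. The tower property then allows any coarser `m`, as required both for the natural
filtration of the process and for conditioning on `X_t` alone. -/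
theorem condExp_next_digit (hmeas : ∀ t, Measurable (i t)) (hindep : iIndepFun i P)
    (hunif : ∀ t a, P (i t ⁻¹' {a}) = (k : ℝ≥0∞)⁻¹) {t : ℕ} (g : (Fin t → Fin k) → Fin k → ℝ)
    (hm : m ≤ digitSigma i t) :
    P[fun ω => g (digitHistory i t ω) (i t ω) | m] =ᵐ[P]
      P[fun ω => (∑ l, g (digitHistory i t ω) l) / k | m] := by
  classical
  have hle : digitSigma i t ≤ ‹MeasurableSpace Ω› := (measurable_digitHistory hmeas t).comap_le
  set e : Fin k → Ω → ℝ := fun l => (i t ⁻¹' {l}).indicator fun _ => 1 with he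
  have hset : ∀ l, MeasurableSet (i t ⁻¹' {l}) := fun l => hmeas t (measurableSet_singleton l)
  have hg : ∀ l, StronglyMeasurable[digitSigma i t] fun ω => g (digitHistory i t ω) l := fun l =>
    ((measurable_of_countable fun y => g y l).comp
      (comap_measurable (digitHistory i t))).stronglyMeasurable
  have hint_e : ∀ l, Integrable (e l) P := fun l => (integrable_const 1).indicator (hset l)
  have hint : ∀ l, Integrable ((fun ω => g (digitHistory i t ω) l) * e l) P := by
    intro l
    exact integrable_digit_function hmeas fun y a =>
      g y l * ({l} : Set (Fin k)).indicator (fun _ => (1 : ℝ)) a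
  have hsum : (fun ω => g (digitHistory i t ω) (i t ω)) =
      ∑ l, (fun ω => g (digitHistory i t ω) l) * e l := by
    funext ω
    simp [he, Finset.sum_apply, Set.indicator_apply]
  have hcond : ∀ l, P[e l | digitSigma i t] =ᵐ[P] fun _ => (k : ℝ)⁻¹ := by
    intro l
    have h1 := condExp_indep_eq (m₁ := MeasurableSpace.comap (i t) inferInstance)
      (m₂ := digitSigma i t) (μ := P) (f := e l) (hmeas t).comap_le hle
      ((stronglyMeasurable_const (b := (1 : ℝ))).indicator ⟨{l}, measurableSet_singleton l, rfl⟩)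
      ((IndepFun_iff_Indep _ _ _).1 (indepFun_digitHistory hmeas hindep t))
    refine h1.trans (ae_of_all _ fun _ => ?_)
    simp only [he]
    rw [integral_indicator_const _ (hset l)]
    simp [measureReal_def, hunif]
  have h1 : P[fun ω => g (digitHistory i t ω) (i t ω) | digitSigma i t] =ᵐ[P]
      fun ω => (∑ l, g (digitHistory i t ω) l) / k := by
    rw [hsum]
    refine (condExp_finsetSum (fun l _ => hint l) (digitSigma i t)).trans ?_
    have h2 : ∀ᵐ ω ∂P, ∀ l, (P[(fun ω => g (digitHistory i t ω) l) * e l | digitSigma i t]) ω =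
        g (digitHistory i t ω) l * (k : ℝ)⁻¹ := by
      rw [ae_all_iff]
      intro l
      filter_upwards [condExp_mul_of_stronglyMeasurable_left (hg l) (hint l) (hint_e l), hcond l]
        with ω h3 h4
      rw [h3, Pi.mul_apply, h4]
    filter_upwards [h2] with ω h
    simp only [Finset.sum_apply, h]
    rw [← Finset.sum_mul, div_eq_mul_inv]
  exact (condExp_condExp_of_le hm hle).symm.trans (condExp_congr_ae h1)

/-- Conditioning on the value at a node forgets which node was reached, but the bound holds at every
node with value in `A`. The function equal to `θ` on that event and `0` elsewhere is measurable for
the coarse σ-algebra, so monotonicity of conditional expectation suffices. -/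
theorem le_condExp_next_digit (hmeas : ∀ t, Measurable (i t)) (hindep : iIndepFun i P)
    (hunif : ∀ t a, P (i t ⁻¹' {a}) = (k : ℝ≥0∞)⁻¹) {t : ℕ} (f : (Fin t → Fin k) → ℝ)
    (g : (Fin t → Fin k) → Fin k → ℝ) (hg : ∀ y l, 0 ≤ g y l) {A : Set ℝ} (hA : MeasurableSet A)
    {θ : ℝ} (h : ∀ y, f y ∈ A → θ * k ≤ ∑ l, g y l) :
    ∀ᵐ ω ∂P, f (digitHistory i t ω) ∈ A →
      θ ≤ expGiven P (fun ω => g (digitHistory i t ω) (i t ω))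
        (fun ω => f (digitHistory i t ω)) ω := by
  classical
  have hf : Measurable f := measurable_of_countable f
  have hH := measurable_digitHistory hmeas t
  set X : Ω → ℝ := fun ω => f (digitHistory i t ω) with hX
  have hm1 : MeasurableSpace.comap X inferInstance ≤ digitSigma i t := by
    rintro s ⟨B, hB, rfl⟩
    exact ⟨f ⁻¹' B, hf hB, rfl⟩
  have hm2 : MeasurableSpace.comap X inferInstance ≤ ‹MeasurableSpace Ω› := (hf.comp hH).comap_le
  set E : Set Ω := X ⁻¹' A with hE
  have hEm : MeasurableSet[MeasurableSpace.comap X inferInstance] E := ⟨A, hA, rfl⟩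
  have hlow : StronglyMeasurable[MeasurableSpace.comap X inferInstance]
      (E.indicator fun _ => θ) := stronglyMeasurable_const.indicator hEm
  have hint : Integrable (E.indicator fun _ => θ) P :=
    (integrable_const θ).indicator (hm2 _ hEm)
  have hmono : P[E.indicator fun _ => θ | MeasurableSpace.comap X inferInstance] ≤ᵐ[P]
      P[fun ω => (∑ l, g (digitHistory i t ω) l) / k |
        MeasurableSpace.comap X inferInstance] := by
    refine condExp_mono hint
      (integrable_digit_function hmeas fun y _ => (∑ l, g y l) / k) (ae_of_all _ fun ω => ?_)
    have hk : 0 < (k : ℝ) := by exact_mod_cast (i 0 ω).pos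
    simp only [Set.indicator_apply]
    split_ifs with hω
    · rw [le_div_iff₀ hk]
      exact h _ hω
    · exact div_nonneg (Finset.sum_nonneg fun l _ => hg _ l) hk.le
  rw [condExp_of_stronglyMeasurable hm2 hlow hint] at hmono
  filter_upwards [hmono, condExp_next_digit hmeas hindep hunif g hm1] with ω h1 h2 hω
  rw [Set.indicator_of_mem (show ω ∈ E from hω), ← h2] at h1
  exact h1

theorem le_probGiven_next_digit (hmeas : ∀ t, Measurable (i t)) (hindep : iIndepFun i P)
    (hunif : ∀ t a, P (i t ⁻¹' {a}) = (k : ℝ≥0∞)⁻¹) {t : ℕ} (f : (Fin t → Fin k) → ℝ)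
    (R : (Fin t → Fin k) → Fin k → Prop) {A : Set ℝ} (hA : MeasurableSet A)
    {θ : ℝ} (h : ∀ y, f y ∈ A → θ * k ≤ ({l | R y l}.ncard : ℝ)) :
    ∀ᵐ ω ∂P, f (digitHistory i t ω) ∈ A →
      θ ≤ probGiven P {ω | R (digitHistory i t ω) (i t ω)}
        (fun ω => f (digitHistory i t ω)) ω := by
  classical
  have := le_condExp_next_digit hmeas hindep hunif f (fun y l => if R y l then 1 else 0)
    (fun y l => by split_ifs <;> norm_num) hA (θ := θ) fun y hy => by
      rw [Finset.sum_boole, ← Set.ncard_coe_finset]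
      simpa using h y hy
  exact this

theorem one_le_ncard_of_mem {l : Fin k} {s : Set (Fin k)} (h : l ∈ s) : (1 : ℝ) ≤ s.ncard := by
  exact_mod_cast (Set.ncard_pos s.toFinite).2 ⟨l, h⟩

/-- A process on the `k`-ary tree, evaluated along a uniformly random branch, is exponentially
locally polarizing if its values at the children of each node polarize. -/
theorem expLocallyPolarizing_of_tree (hmeas : ∀ t, Measurable (i t)) (hindep : iIndepFun i P)
    (hunif : ∀ t a, P (i t ⁻¹' {a}) = (k : ℝ≥0∞)⁻¹) {η b : ℝ}
    (F : ∀ t, (Fin t → Fin k) → ℝ) (h01 : ∀ t y, F t y ∈ Set.Icc (0 : ℝ) 1)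
    (havg : ∀ t y, ∑ l, F (t + 1) (Fin.snoc y l) = k * F t y)
    (hvar : ∀ τ : ℝ, 0 < τ → ∃ ε : ℝ, 0 < ε ∧ ∀ t y, F t y ∈ Set.Ioo τ (1 - τ) →
      ∃ l, F t y + ε ≤ F (t + 1) (Fin.snoc y l))
    (hlow : ∀ c : ℝ, 0 < c → ∃ τ : ℝ, 0 < τ ∧ ∀ t y, F t y ≤ τ →
      ∃ l, F (t + 1) (Fin.snoc y l) ≤ F t y / c)
    (hhigh : ∀ c : ℝ, 0 < c → ∃ τ : ℝ, 0 < τ ∧ ∀ t y, 1 - F t y ≤ τ →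
      ∃ l, 1 - F (t + 1) (Fin.snoc y l) ≤ (1 - F t y) / c)
    (hstrong : ∃ τ : ℝ, 0 < τ ∧ ∀ t y, F t y ≤ τ →
      η * k ≤ ({l | F (t + 1) (Fin.snoc y l) ≤ F t y ^ b}.ncard : ℝ)) :
    ExpLocallyPolarizing (fun t ω => F t (digitHistory i t ω)) P η b := by
  have hF : ∀ t, Measurable (F t) := fun t => measurable_of_countable _
  have hX : ∀ t, Measurable fun ω => F t (digitHistory i t ω) := fun t =>
    (hF t).comp (measurable_digitHistory hmeas t)
  have hsucc : ∀ t ω, F (t + 1) (digitHistory i (t + 1) ω) =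
      F (t + 1) (Fin.snoc (digitHistory i t ω) (i t ω)) := fun t ω => by rw [digitHistory_succ]
  have hk : 0 < (k : ℝ) := by
    obtain ⟨ω⟩ := nonempty_of_isProbabilityMeasure P
    exact_mod_cast (i 0 ω).pos
  refine { mem_Icc := fun t ω => h01 t _, martingale := ?_, variance_in_the_middle := ?_,
           suction_at_the_ends := ?_, strong_suction_at_the_low_end := ?_ }
  · refine ⟨fun t => (hX t).stronglyMeasurable, martingale_nat
      (Filtration.stronglyAdapted_natural _) (fun t => ?_) fun t => ?_⟩
    · exact integrable_digit_function hmeas fun y _ => F t y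
    · set 𝒢 := Filtration.natural (fun t ω => F t (digitHistory i t ω))
        fun t => (hX t).stronglyMeasurable
      -- Each value up to time `t` is a function of a prefix of the first `t` digits.
      have hm : 𝒢 t ≤ digitSigma i t := by
        refine iSup₂_le fun s hs => ?_
        rintro _ ⟨B, hB, rfl⟩
        refine ⟨(fun y : Fin t → Fin k => F s fun a => y (Fin.castLE hs a)) ⁻¹' B,
          (measurable_of_countable _) hB, rfl⟩
      have h1 := condExp_next_digit hmeas hindep hunif (fun y l => F (t + 1) (Fin.snoc y l)) hm
      simp only [havg, mul_div_cancel_left₀ _ hk.ne', ← hsucc] at h1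
      rw [condExp_of_stronglyMeasurable (𝒢.le t)
        (Filtration.stronglyAdapted_natural (fun t => (hX t).stronglyMeasurable) t)
        (integrable_digit_function hmeas fun y _ => F t y)] at h1
      exact h1.symm
  · intro τ hτ
    obtain ⟨ε, hε, h⟩ := hvar τ hτ
    -- One child moves by at least `ε` and is chosen with probability `1 / k`.
    refine ⟨ε ^ 2 / k, by positivity, fun t => ?_⟩
    simp only [hsucc]
    refine le_condExp_next_digit hmeas hindep hunif (F t)
      (fun y l => (F (t + 1) (Fin.snoc y l) - F t y) ^ 2) (fun y l => sq_nonneg _)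
      measurableSet_Ioo fun y hy => ?_
    obtain ⟨l, hl⟩ := h t y hy
    rw [div_mul_cancel₀ _ hk.ne']
    refine le_trans ?_ (Finset.single_le_sum
      (f := fun l => (F (t + 1) (Fin.snoc y l) - F t y) ^ 2)
      (fun l _ => sq_nonneg _) (Finset.mem_univ l))
    exact pow_le_pow_left₀ hε.le (by linarith) 2
  -- The probability of the single good child does not depend on `c`; only the threshold does.
  · refine ⟨(k : ℝ)⁻¹, by positivity, fun c hc => ?_⟩
    obtain ⟨τ₁, hτ₁, h₁⟩ := hlow c hc
    obtain ⟨τ₂, hτ₂, h₂⟩ := hhigh c hc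
    refine ⟨min τ₁ τ₂, lt_min hτ₁ hτ₂, fun t => ?_⟩
    simp only [hsucc]
    have hl := le_probGiven_next_digit hmeas hindep hunif (F t)
      (fun y l => F (t + 1) (Fin.snoc y l) ≤ F t y / c) (A := Set.Iic (min τ₁ τ₂))
      (θ := (k : ℝ)⁻¹) measurableSet_Iic fun y hy => by
        obtain ⟨l, hl⟩ := h₁ t y (hy.trans (min_le_left _ _))
        rw [inv_mul_cancel₀ hk.ne']
        exact one_le_ncard_of_mem hl
    have hh := le_probGiven_next_digit hmeas hindep hunif (F t)
      (fun y l => 1 - F (t + 1) (Fin.snoc y l) ≤ (1 - F t y) / c)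
      (A := {x | 1 - x ≤ min τ₁ τ₂}) (θ := (k : ℝ)⁻¹)
      (measurableSet_le (by fun_prop) measurable_const) fun y hy => by
        obtain ⟨l, hl⟩ := h₂ t y (le_trans hy (min_le_right _ _))
        rw [inv_mul_cancel₀ hk.ne']
        exact one_le_ncard_of_mem hl
    filter_upwards [hl, hh] with ω h3 h4
    exact ⟨h3, h4⟩
  · obtain ⟨τ, hτ, h⟩ := hstrong
    refine ⟨τ, hτ, fun t => ?_⟩
    simp only [hsucc]
    exact le_probGiven_next_digit hmeas hindep hunif (F t)
      (fun y l => F (t + 1) (Fin.snoc y l) ≤ F t y ^ b) (A := Set.Iic τ) measurableSet_Iic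
      fun y hy => h t y hy

end DigitProcess

theorem lemma2p7 {q : ℕ} [Fact q.Prime] {k : ℕ} (M : Matrix (Fin k) (Fin k) (ZMod q))
    (hmix : IsMixing M) (η b : ℝ) (hM : ExpPolarizingMatrix.{u} M η b)
    {Y : Type u} (C : ZMod q → PMF Y)
    {Ω : Type v} [MeasurableSpace Ω] (P : Measure Ω) [IsProbabilityMeasure P]
    (i : ℕ → Ω → Fin k) (hmeas : ∀ t, Measurable (i t)) (hindep : iIndepFun i P)
    (hunif : ∀ t a, P (i t ⁻¹' {a}) = (k : ℝ≥0∞)⁻¹) :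
    ExpLocallyPolarizing (arikanMartingale M C i) P η b := by
  have hs := fun {t : ℕ} => arikanEntropy_snoc hmix.1 C (t := t)
  refine expLocallyPolarizing_of_tree hmeas hindep hunif
    (fun t => arikanEntropy M C (t := t)) (fun t y => condEntropy_mem_Icc _) (fun t y => ?_)
    (fun τ hτ => ?_) (fun c hc => ?_) (fun c hc => ?_) ?_
  · simp only [hs]
    exact sum_condEntropy_matrixStep _ hmix.1
  · obtain ⟨ε, hε, h⟩ := matrixStep_variance.{u} hmix hτ
    refine ⟨ε, hε, fun t y hy => ?_⟩
    simp only [hs]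
    exact h _ _ hy
  · obtain ⟨τ, hτ, h⟩ := matrixStep_suction_low.{u} hmix hc
    refine ⟨τ, hτ, fun t y hy => ?_⟩
    simp only [hs]
    exact h _ _ hy
  · obtain ⟨τ, hτ, h⟩ := matrixStep_suction_high.{u} hmix hc
    refine ⟨τ, hτ, fun t y hy => ?_⟩
    simp only [hs]
    exact h _ _ hy
  · obtain ⟨τ, hτ, h⟩ := hM
    -- Halving turns the non-strict `X ≤ τ` of the conclusion into the strict `δ < τ` of the
    -- hypothesis, which is applied with `δ` equal to the entropy at the node.
    refine ⟨τ / 2, by positivity, fun t y hy => ?_⟩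
    simp only [hs]
    exact h _ (by linarith) _ _ le_rfl
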